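/- **Asymptotic variance of $N_t$ in the buffer-Hawkes process.** Let $\lambda_0>0$, $a\ge 0$, $b>0$, $c>0$, $d\ge 0$ satisfy the stability condition $ac<b(c+d)$. Let $S=\mathbb R_+\times\mathbb N\times\mathbb N$ with $\mathbb N=\{0,1,2,\dots\}$, and for $f:S\to\mathbb R$ continuously differentiable in its first variable put $$\mathcal L f(\lambda,\gamma,n)=b(\lambda_0-\lambda)\,\partial_\lambda f(\lambda,\gamma,n)+\lambda\big(f(\lambda,\gamma+1,n)-f(\lambda,\gamma,n)\big)+d\gamma\big(f(\lambda,\gamma-1,n)-f(\lambda,\gamma,n)\big)+c\gamma\big(f(\lambda+a,\gamma-1,n+1)-f(\lambda,\gamma,n)\big),$$ where the last two terms are $0$ if $\gamma=0$. Let $X_t=(\Lambda_t,\Gamma_t,N_t)$, $t\ge 0$, be a buffer-Hawkes process with these parameters, that is, an adapted $S$-valued process with càdlàg paths on a probability space with a filtration $\mathcal F=(\mathcal F_t)_{t\ge0}$, with $X_0=(\lambda_0,0,0)$ almost surely and with generator $\mathcal L$, in the sense that $$f(X_t)-\int_0^t\mathcal L f(X_s)\,ds,\qquad t\ge 0,$$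 is an $\mathcal F$-martingale for every $f$ that is continuously differentiable in its first variable and for which $f$ and $\mathcal L f$ are bounded on $S$. Then $\mathbb E(N_t^2)<\infty$ for every $t\ge0$, and the variance $V(N_t)$ of $N_t$ satisfies $$V(N_t)\;\sim\;\frac{\lambda_0c}{c+d}\Big(\frac{b(c+d)}{b(c+d)-ac}\Big)^3\,t\qquad (t\to\infty),$$ that is, the ratio of the two sides tends to $1$. -/

import Mathlib

open MeasureTheory ProbabilityTheory Filter Topology Asymptotics
open scoped NNReal

noncomputable section

namespace BufferHawkes

/-- The state space `ℝ₊ × ℕ × ℕ`. A state is a triple `(l, g, n)`: the intensity `l` of arriving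
limit orders, the size `g` of the limit order book, the number `n` of executed market orders. -/
abbrev State : Type := ℝ≥0 × ℕ × ℕ

/-- The generator of the buffer-Hawkes process with parameters `lam0, a, b, c, d`:
* between jumps, the intensity reverts to the base level `lam0` at rate `b`;
* a limit order arrives at rate `l`;
* each of the `g` orders in the book is cancelled at rate `d`;
* each of the `g` orders in the book is executed at rate `c`, and the execution increases the
  intensity `l` by `a`.
The value `g - 1` is immaterial when `g = 0`, since it then has the coefficient `0`. -/
def generator (lam0 a b c d : ℝ) (f : ℝ → ℕ → ℕ → ℝ) (l : ℝ) (g n : ℕ) : ℝ :=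
  b * (lam0 - l) * deriv (fun x => f x g n) l
    + l * (f l (g + 1) n - f l g n)
    + d * (g : ℝ) * (f l (g - 1) n - f l g n)
    + c * (g : ℝ) * (f (l + a) (g - 1) (n + 1) - f l g n)

/-- Test functions: continuously differentiable in the first variable, and bounded on the state
space together with their image under the generator. (A continuously differentiable function on
`[0, ∞)` extends to one on `ℝ`, and only values at `l ≥ 0` are used, if `a ≥ 0`.) -/
structure IsTestFunction (lam0 a b c d : ℝ) (f : ℝ → ℕ → ℕ → ℝ) : Prop where
  contDiff : ∀ g n, ContDiff ℝ 1 (fun l => f l g n)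
  bounded : ∃ C : ℝ, ∀ x : State, |f x.1 x.2.1 x.2.2| ≤ C
  bounded_generator : ∃ C : ℝ, ∀ x : State, |generator lam0 a b c d f x.1 x.2.1 x.2.2| ≤ C

/-- A path is càdlàg: right-continuous with left limits in the state space. -/
def IsCadlagPath (x : ℝ≥0 → State) : Prop :=
  ∀ t, ContinuousWithinAt x (Set.Ici t) t ∧ ∃ y, Tendsto x (𝓝[<] t) (𝓝 y)

/-- `X = (Λ, Γ, N)` is a buffer-Hawkes process with parameters `lam0, a, b, c, d` with respect to
the filtration `ℱ`: an adapted process with càdlàg paths in the state space, started in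
`(lam0, 0, 0)`, that solves the martingale problem for the generator. -/
structure IsBufferHawkes {Ω : Type*} {mΩ : MeasurableSpace Ω} (lam0 a b c d : ℝ)
    (μ : Measure Ω) (ℱ : Filtration ℝ≥0 mΩ) (X : ℝ≥0 → Ω → State) : Prop where
  adapted : ∀ t, Measurable[ℱ t] (X t)
  cadlag : ∀ ω, IsCadlagPath (fun t => X t ω)
  initial : ∀ᵐ ω ∂μ, ((X 0 ω).1 : ℝ) = lam0 ∧ (X 0 ω).2.1 = 0 ∧ (X 0 ω).2.2 = 0
  martingale : ∀ f : ℝ → ℕ → ℕ → ℝ, IsTestFunction lam0 a b c d f →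
    Martingale (fun (t : ℝ≥0) (ω : Ω) =>
      f (X t ω).1 (X t ω).2.1 (X t ω).2.2
        - ∫ s in (0 : ℝ)..t, generator lam0 a b c d f
            (X s.toNNReal ω).1 (X s.toNNReal ω).2.1 (X s.toNNReal ω).2.2) ℱ μ

end BufferHawkes

end

/-!
The linear form `h = (c / D) Λ + (b c / D) Γ + N`, where `D = b (c + d) - a c`, is mapped by the
generator to a constant. So `h(X_t)` is a martingale up to a deterministic drift, and its variance
is the time integral of the mean of the squared jumps of `h`, weighted by their rates, which is a
linear combination of `∫ E Λ_s ds` and `∫ E Γ_s ds` (`IsBufferHawkes.variance_linForm`). Dynkin's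
formula for `Λ` and for `Γ` gives two linear equations for these two integrals
(`IsBufferHawkes.integral_means`), and no differential equation has to be solved: up to multiples of
`E Λ_t` and `E Γ_t`, the integrals are linear in `t`, and the slope of `Var h(X_t)` comes out as the
constant of the theorem.

The remaining terms are bounded in time. The stability condition provides `ρ > 0` for which `v = Λ +
ρ Γ` satisfies `L (v ^ 2) ≤ C - δ v ^ 2` with `δ > 0`, whence `E v(X_t) ^ 2` is bounded
(`IsBufferHawkes.exists_integral_sq_le`). In particular `N` differs from `h` by a linear form with
bounded second moment, and by the Cauchy–Schwarz inequality `Var N_t` differs from `Var h(X_t)` by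
`O(√t)` (`IsBufferHawkes.exists_abs_variance_sub_le`).

The martingale problem is given for bounded test functions only, while the argument uses squares of
linear forms. Let `Q = 1 + Λ ^ 4 + (Γ + N) ^ 4`. The truncations `k Q / (k + Q)` are test functions
whose images under the generator are at most a multiple of them, uniformly in `k`; Gronwall's
inequality and Fatou's lemma give `E Q(X_t) ≤ Q(X_0) e ^ (C t)`
(`IsBufferHawkes.exists_integral_lyap_le`). For `p` of quadratic growth, `p k / (k + Q)` is a test
function whose image under the generator is dominated by a multiple of `Q`, uniformly in `k`, so
that dominated convergence gives Dynkin's formula for `p` (`IsBufferHawkes.satisfiesDynkin`).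
-/

noncomputable section

namespace BufferHawkes

/-! ### Joint measurability -/

/-- A function of real intensity, book size and count, regarded as a function of the state. -/
def onState (f : ℝ → ℕ → ℕ → ℝ) (x : State) : ℝ := f x.1 x.2.1 x.2.2

lemma measurable_onState {f : ℝ → ℕ → ℕ → ℝ} (hf : ∀ g n, Measurable (fun l => f l g n)) :
    Measurable (onState f) := by
  refine measurable_from_prod_countable_left fun y => ?_
  exact (hf y.1 y.2).comp measurable_coe_nnreal_real

lemma measurable_generator {lam0 a b c d : ℝ} {f : ℝ → ℕ → ℕ → ℝ}
    (hf : ∀ g n, Measurable (fun l => f l g n)) (g n : ℕ) :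
    Measurable (fun l => generator lam0 a b c d f l g n) := by
  unfold generator
  have h1 := hf g n
  have h2 := hf (g + 1) n
  have h3 := hf (g - 1) n
  have h4 := (hf (g - 1) (n + 1)).comp (measurable_id.add_const a)
  have h5 := measurable_deriv (fun x => f x g n)
  simp only [Function.comp_def, id_eq] at h4
  fun_prop

/-- A right-continuous process is jointly measurable in time and chance: it is the pointwise limit
of the processes that look, at time `t`, at the state at the next multiple of `1 / (k + 1)`. -/
lemma measurable_uncurry_of_rightContinuous {Ω E : Type*} [MeasurableSpace Ω]
    [TopologicalSpace E] [TopologicalSpace.PseudoMetrizableSpace E] [MeasurableSpace E]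
    [BorelSpace E] {X : ℝ≥0 → Ω → E}
    (hX : ∀ t, Measurable (X t)) (hr : ∀ ω t, ContinuousWithinAt (fun s => X s ω) (Set.Ici t) t) :
    Measurable (fun p : ℝ≥0 × Ω => X p.1 p.2) := by
  have hstep : ∀ k : ℕ, Measurable (fun p : ℝ≥0 × Ω =>
      X ((⌈p.1 * (k + 1)⌉₊ : ℝ≥0) / (k + 1)) p.2) := by
    intro k
    have h1 : Measurable (fun q : ℕ × Ω => X ((q.1 : ℝ≥0) / (k + 1)) q.2) :=
      measurable_from_prod_countable_right fun m => hX ((m : ℝ≥0) / (k + 1))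
    have h2 : Measurable (fun p : ℝ≥0 × Ω => (⌈p.1 * (k + 1)⌉₊, p.2)) :=
      (Nat.measurable_ceil.comp (measurable_fst.mul_const _)).prodMk measurable_snd
    exact h1.comp h2
  refine measurable_of_tendsto_metrizable hstep ?_
  rw [tendsto_pi_nhds]
  rintro ⟨t, ω⟩
  refine (hr ω t).tendsto.comp (tendsto_nhdsWithin_iff.2 ⟨?_, .of_forall fun k => ?_⟩)
  · have hk : Tendsto (fun k : ℕ => t + 1 / ((k : ℝ≥0) + 1)) atTop (𝓝 t) := by
      simpa using tendsto_const_nhds.add (tendsto_one_div_add_atTop_nhds_zero_nat (𝕜 := ℝ≥0))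
    refine tendsto_of_tendsto_of_tendsto_of_le_of_le tendsto_const_nhds hk (fun k => ?_)
      (fun k => ?_)
    · have : (0 : ℝ≥0) < (k : ℝ≥0) + 1 := by positivity
      exact (le_div_iff₀ this).2 (Nat.le_ceil _)
    · have : (0 : ℝ≥0) < (k : ℝ≥0) + 1 := by positivity
      refine (div_le_iff₀ this).2 ?_
      have h := (Nat.ceil_lt_add_one (zero_le (a := t * ((k : ℝ≥0) + 1)))).le
      rwa [add_mul, one_div, inv_mul_cancel₀ this.ne']
  · have : (0 : ℝ≥0) < (k : ℝ≥0) + 1 := by positivity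
    exact (le_div_iff₀ this).2 (Nat.le_ceil _)

/-! ### Dynkin's formula for bounded test functions -/

section Dynkin

variable {Ω : Type*} {mΩ : MeasurableSpace Ω} {μ : Measure Ω}
  {ℱ : Filtration ℝ≥0 mΩ} {lam0 a b c d : ℝ} {X : ℝ≥0 → Ω → State}

lemma IsBufferHawkes.measurable (hX : IsBufferHawkes lam0 a b c d μ ℱ X) (t : ℝ≥0) :
    Measurable (X t) :=
  (hX.adapted t).mono (ℱ.le t) le_rfl

/-- A buffer-Hawkes process, extended by its initial state to negative times, is jointly
measurable. -/
lemma IsBufferHawkes.measurable_uncurry (hX : IsBufferHawkes lam0 a b c d μ ℱ X) :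
    Measurable (fun p : ℝ × Ω => X p.1.toNNReal p.2) := by
  have h := measurable_uncurry_of_rightContinuous hX.measurable
    (fun ω t => (hX.cadlag ω t).1)
  exact h.comp ((measurable_real_toNNReal.comp measurable_fst).prodMk measurable_snd)

variable [IsProbabilityMeasure μ]

lemma IsBufferHawkes.stronglyMeasurable_expectation (hX : IsBufferHawkes lam0 a b c d μ ℱ X)
    {F : State → ℝ} (hF : Measurable F) :
    StronglyMeasurable (fun s : ℝ => ∫ ω, F (X s.toNNReal ω) ∂μ) :=
  (hF.comp hX.measurable_uncurry).stronglyMeasurable.integral_prod_right'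
    (f := fun p : ℝ × Ω => F (X p.1.toNNReal p.2))

lemma integrable_of_bounded {F : State → ℝ} (hF : Measurable F) {C : ℝ} (hC : ∀ x, |F x| ≤ C)
    {Y : Ω → State} (hY : Measurable Y) : Integrable (fun ω => F (Y ω)) μ :=
  .of_bound (hF.comp hY).aestronglyMeasurable C (.of_forall fun _ => hC _)

/-- Dynkin's formula for a test function. -/
lemma IsBufferHawkes.dynkin_of_isTestFunction (hX : IsBufferHawkes lam0 a b c d μ ℱ X)
    {f : ℝ → ℕ → ℕ → ℝ} (hf : IsTestFunction lam0 a b c d f) (t : ℝ≥0) :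
    ∫ ω, onState f (X t ω) ∂μ = f lam0 0 0
      + ∫ s in (0 : ℝ)..t, ∫ ω, onState (generator lam0 a b c d f) (X s.toNNReal ω) ∂μ := by
  obtain ⟨C, hC⟩ := hf.bounded
  obtain ⟨C', hC'⟩ := hf.bounded_generator
  have hfm : ∀ g n, Measurable (fun l => f l g n) := fun g n =>
    (hf.contDiff g n).continuous.measurable
  have hm := measurable_onState hfm
  have hm' := measurable_onState (measurable_generator (lam0 := lam0) (a := a) (b := b) (c := c)
    (d := d) hfm)
  have hprod : Integrable (Function.uncurry fun (s : ℝ) (ω : Ω) =>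
      onState (generator lam0 a b c d f) (X s.toNNReal ω))
      ((volume.restrict (Set.uIoc (0 : ℝ) t)).prod μ) := by
    have : IsFiniteMeasure (volume.restrict (Set.uIoc (0 : ℝ) t)) := by
      rw [Set.uIoc]; infer_instance
    exact .of_bound (hm'.comp hX.measurable_uncurry).aestronglyMeasurable C'
      (.of_forall fun p => hC' _)
  rw [intervalIntegral_integral_swap hprod]
  have hmart := (hX.martingale f hf).setIntegral_eq (zero_le (a := t)) MeasurableSet.univ
  have hint : Integrable (fun ω => onState f (X t ω)) μ := integrable_of_bounded hm hC
    (hX.measurable t)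
  have hM := (hX.martingale f hf).integrable t
  simp only [setIntegral_univ, NNReal.coe_zero, intervalIntegral.integral_same, sub_zero] at hmart
  have hint2 : Integrable (fun ω => ∫ s in (0 : ℝ)..t,
      onState (generator lam0 a b c d f) (X s.toNNReal ω)) μ := by
    refine (hint.sub hM).congr (.of_forall fun ω => ?_)
    simp [onState]
  have h0 : ∫ ω, f (X 0 ω).1 (X 0 ω).2.1 (X 0 ω).2.2 ∂μ = f lam0 0 0 := by
    have : ∀ᵐ ω ∂μ, f (X 0 ω).1 (X 0 ω).2.1 (X 0 ω).2.2 = f lam0 0 0 := by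
      filter_upwards [hX.initial] with ω h
      rw [h.1, h.2.1, h.2.2]
    rw [integral_congr_ae this]; simp
  have hs := integral_sub hint hint2
  rw [← h0, hmart]
  simp only [onState] at hs ⊢
  rw [hs]; ring

end Dynkin

/-! ### The Lyapunov function -/

/-- The size of a state. At nonnegative intensity it is at least `1`, and the jump rates and the
drift of the process are at most of this order. -/
def size (l : ℝ) (g n : ℕ) : ℝ := 1 + l + g + n

/-- A quartic Lyapunov function. It is positive for all real `l`, so that its reciprocal gives
smooth cutoffs, and it dominates the cube of the size of a state, that is, the image under the
generator of any function of quadratic growth. -/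
def lyap (l : ℝ) (g n : ℕ) : ℝ := 1 + l ^ 4 + ((g : ℝ) + n) ^ 4

/-- The cutoff `k / (k + lyap)`, which increases to `1` as `k → ∞`. -/
def cutoff (k : ℝ) (l : ℝ) (g n : ℕ) : ℝ := k / (k + lyap l g n)

lemma one_le_lyap (l : ℝ) (g n : ℕ) : 1 ≤ lyap l g n := by
  unfold lyap
  have : 0 ≤ l ^ 4 := by positivity
  have : 0 ≤ ((g : ℝ) + n) ^ 4 := by positivity
  linarith

lemma one_le_size {l : ℝ} (hl : 0 ≤ l) (g n : ℕ) : 1 ≤ size l g n := by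
  unfold size
  have : 0 ≤ (g : ℝ) := g.cast_nonneg
  have : 0 ≤ (n : ℝ) := n.cast_nonneg
  linarith

lemma size_pow_four_le {l : ℝ} (g n : ℕ) : size l g n ^ 4 ≤ 27 * lyap l g n := by
  unfold size lyap
  generalize hs : (g : ℝ) + n = s
  have h1 : (1 + l + g + n : ℝ) = 1 + l + s := by rw [← hs]; ring
  rw [h1]
  have h2 : (1 + l + s) ^ 2 ≤ 3 * (1 + l ^ 2 + s ^ 2) := by
    nlinarith [sq_nonneg (1 - l), sq_nonneg (1 - s), sq_nonneg (l - s)]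
  have h3 : (1 + l ^ 2 + s ^ 2) ^ 2 ≤ 3 * (1 + l ^ 4 + s ^ 4) := by
    nlinarith [sq_nonneg (1 - l ^ 2), sq_nonneg (1 - s ^ 2), sq_nonneg (l ^ 2 - s ^ 2)]
  calc (1 + l + s) ^ 4 = ((1 + l + s) ^ 2) ^ 2 := by ring
    _ ≤ (3 * (1 + l ^ 2 + s ^ 2)) ^ 2 := by gcongr
    _ = 9 * (1 + l ^ 2 + s ^ 2) ^ 2 := by ring
    _ ≤ 27 * (1 + l ^ 4 + s ^ 4) := by linarith

lemma size_pow_le {l : ℝ} (hl : 0 ≤ l) (g n : ℕ) {m : ℕ} (hm : m ≤ 4) :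
    size l g n ^ m ≤ 27 * lyap l g n :=
  (pow_le_pow_right₀ (one_le_size hl g n) hm).trans (size_pow_four_le g n)

lemma hasDerivAt_lyap (l : ℝ) (g n : ℕ) :
    HasDerivAt (fun x => lyap x g n) (4 * l ^ 3) l := by
  unfold lyap
  simpa using ((hasDerivAt_pow 4 l).const_add 1).add_const (((g : ℝ) + n) ^ 4)

lemma contDiff_lyap (g n : ℕ) : ContDiff ℝ 1 (fun l => lyap l g n) := by
  unfold lyap
  fun_prop

/-- None of the three kinds of jump decreases the Lyapunov function by more than a constant factor,
so that the cutoff before a jump controls the cutoff after it. Arrivals do not decrease it. -/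
lemma lyap_le_lyap_arrival (l : ℝ) (g n : ℕ) : lyap l g n ≤ lyap l (g + 1) n := by
  unfold lyap
  push_cast
  gcongr
  linarith

lemma lyap_le_lyap_cancel (l : ℝ) (g n : ℕ) : lyap l g n ≤ 16 * lyap l (g - 1) n := by
  unfold lyap
  have h1 : (g : ℝ) ≤ ((g - 1 : ℕ) : ℝ) + 1 := by exact_mod_cast (by omega : g ≤ g - 1 + 1)
  set s : ℝ := ((g - 1 : ℕ) : ℝ) + n
  have hs : (g : ℝ) + n ≤ s + 1 := by simp only [s]; linarith
  have h2 : (s + 1) ^ 4 ≤ 8 * (1 + s ^ 4) := by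
    have h3 : (s + 1) ^ 2 ≤ 2 * (1 + s ^ 2) := by nlinarith [sq_nonneg (s - 1)]
    have h4 : (1 + s ^ 2) ^ 2 ≤ 2 * (1 + s ^ 4) := by nlinarith [sq_nonneg (s ^ 2 - 1)]
    calc (s + 1) ^ 4 = ((s + 1) ^ 2) ^ 2 := by ring
      _ ≤ (2 * (1 + s ^ 2)) ^ 2 := by gcongr
      _ ≤ 8 * (1 + s ^ 4) := by linarith
  have h5 : ((g : ℝ) + n) ^ 4 ≤ (s + 1) ^ 4 := by gcongr
  have : 0 ≤ l ^ 4 := by positivity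
  have : 0 ≤ s ^ 4 := by positivity
  linarith

/-- An execution moves an order from the book to the count, so that `g + n` is unchanged if `0 < g`;
if `g = 0`, truncated subtraction makes it increase. -/
lemma lyap_le_lyap_execution {l a : ℝ} (hl : 0 ≤ l) (ha : 0 ≤ a) (g n : ℕ) :
    lyap l g n ≤ lyap (l + a) (g - 1) (n + 1) := by
  unfold lyap
  have h1 : (g : ℝ) + n ≤ ((g - 1 : ℕ) : ℝ) + ((n + 1 : ℕ) : ℝ) := by
    exact_mod_cast (by omega : g + n ≤ g - 1 + (n + 1))
  gcongr
  linarith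

lemma size_arrival_le {l : ℝ} (hl : 0 ≤ l) (g n : ℕ) : size l (g + 1) n ≤ 2 * size l g n := by
  have := one_le_size hl g n
  unfold size at *
  push_cast
  linarith

lemma size_cancel_le {l : ℝ} (g n : ℕ) : size l (g - 1) n ≤ size l g n := by
  unfold size
  gcongr
  omega

lemma size_execution_le {l a : ℝ} (hl : 0 ≤ l) (ha : 0 ≤ a) (g n : ℕ) :
    size (l + a) (g - 1) (n + 1) ≤ (2 + a) * size l g n := by
  have h1 := one_le_size hl g n
  have h2 : ((g - 1 : ℕ) : ℝ) ≤ g := by exact_mod_cast Nat.sub_le g 1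
  have h3 := mul_le_mul_of_nonneg_left h1 ha
  unfold size at *
  push_cast
  linarith

lemma le_size {l : ℝ} (g n : ℕ) : l ≤ size l g n := by
  unfold size
  have : 0 ≤ (g : ℝ) := g.cast_nonneg
  have : 0 ≤ (n : ℝ) := n.cast_nonneg
  linarith

lemma abs_drift_le {lam0 b l : ℝ} (hlam0 : 0 ≤ lam0) (hb : 0 ≤ b) (hl : 0 ≤ l) (g n : ℕ) :
    |b * (lam0 - l)| ≤ b * (lam0 + 1) * size l g n := by
  have h1 : |lam0 - l| ≤ (lam0 + 1) * size l g n := by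
    have h0 := one_le_size hl g n
    have h2 := le_size (l := l) g n
    rw [abs_le]
    constructor <;> nlinarith
  rw [abs_mul, abs_of_nonneg hb, mul_assoc]
  gcongr

lemma natCast_le_size {l : ℝ} (hl : 0 ≤ l) (g n : ℕ) : (g : ℝ) ≤ size l g n := by
  unfold size
  have : 0 ≤ (n : ℝ) := n.cast_nonneg
  linarith

lemma natCast_add_le_size {l : ℝ} (hl : 0 ≤ l) (g n : ℕ) : (g : ℝ) + n ≤ size l g n := by
  unfold size
  linarith

/-- The triangle inequality for the generator, at a state of nonnegative intensity. -/
lemma abs_generator_le {lam0 a b c d : ℝ} (hc : 0 ≤ c) (hd : 0 ≤ d) (f : ℝ → ℕ → ℕ → ℝ) {l : ℝ}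
    (hl : 0 ≤ l) (g n : ℕ) :
    |generator lam0 a b c d f l g n| ≤ |b * (lam0 - l)| * |deriv (fun x => f x g n) l|
      + l * |f l (g + 1) n - f l g n| + d * g * |f l (g - 1) n - f l g n|
      + c * g * |f (l + a) (g - 1) (n + 1) - f l g n| := by
  unfold generator
  refine (abs_add_le _ _).trans (add_le_add ((abs_add_le _ _).trans (add_le_add
    ((abs_add_le _ _).trans (add_le_add ?_ ?_)) ?_)) ?_)
  · rw [abs_mul]
  · rw [abs_mul, abs_of_nonneg hl]
  · rw [abs_mul, abs_of_nonneg (by positivity : 0 ≤ d * (g : ℝ))]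
  · rw [abs_mul, abs_of_nonneg (by positivity : 0 ≤ c * (g : ℝ))]

/-- Drift and jumps of the Lyapunov function are, in absolute value and weighted by their rates, at
most a multiple of the Lyapunov function. -/
lemma exists_lyap_increment_le {lam0 a b c d : ℝ} (hlam0 : 0 ≤ lam0) (ha : 0 ≤ a) (hb : 0 ≤ b)
    (hc : 0 ≤ c) (hd : 0 ≤ d) :
    ∃ C : ℝ, 0 ≤ C ∧ ∀ (l : ℝ) (g n : ℕ), 0 ≤ l →
      |b * (lam0 - l)| * |4 * l ^ 3| ≤ C * lyap l g n ∧
      l * |lyap l (g + 1) n - lyap l g n| ≤ C * lyap l g n ∧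
      d * g * |lyap l (g - 1) n - lyap l g n| ≤ C * lyap l g n ∧
      c * g * |lyap (l + a) (g - 1) (n + 1) - lyap l g n| ≤ C * lyap l g n := by
  set A := 4 * a + 6 * a ^ 2 + 4 * a ^ 3 + a ^ 4 with hA
  have hA0 : 0 ≤ A := by positivity
  set C0 := b * (lam0 + 1) * 4 + 15 + d * 15 + c * A with hC0
  have e1 : 0 ≤ b * (lam0 + 1) * 4 := by positivity
  have e3 : 0 ≤ d * 15 := by positivity
  have e4 : 0 ≤ c * A := by positivity
  refine ⟨C0 * 27, by positivity, fun l g n hl => ?_⟩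
  have hV1 := one_le_size hl g n
  have hlV := le_size (l := l) g n
  have hgV := natCast_le_size hl g n
  have hsV := natCast_add_le_size hl g n
  set V := size l g n with hV
  have hV0 : 0 ≤ V := by linarith
  have key : ∀ {x y : ℝ}, y ≤ C0 → x ≤ y * V ^ 4 → x ≤ C0 * 27 * lyap l g n := by
    intro x y hy hx
    calc x ≤ y * V ^ 4 := hx
      _ ≤ C0 * V ^ 4 := by gcongr
      _ ≤ C0 * (27 * lyap l g n) := by gcongr; exact size_pow_four_le g n
      _ = _ := by ring
  -- the effect of a unit step of `s = g + n` on `s ^ 4`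
  have hstep : ∀ s : ℝ, 0 ≤ s → s ≤ V → (s + 1) ^ 4 - s ^ 4 ≤ 15 * V ^ 3 := by
    intro s hs hsV
    have h1 : s ^ 2 ≤ V ^ 3 := (pow_le_pow_left₀ hs hsV 2).trans (pow_le_pow_right₀ hV1 (by simp))
    have h2 : s ^ 3 ≤ V ^ 3 := pow_le_pow_left₀ hs hsV 3
    have h3 : s ≤ V ^ 3 := hsV.trans (le_self_pow₀ hV1 (by simp))
    have h4 : 1 ≤ V ^ 3 := one_le_pow₀ hV1
    linarith
  refine ⟨key (y := b * (lam0 + 1) * 4) (by linarith) ?_, key (y := 15) (by linarith) ?_,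
    key (y := d * 15) (by linarith) ?_, key (y := c * A) (by linarith) ?_⟩
  · rw [abs_of_nonneg (by positivity : 0 ≤ 4 * l ^ 3)]
    calc |b * (lam0 - l)| * (4 * l ^ 3) ≤ (b * (lam0 + 1) * V) * (4 * V ^ 3) := by
          gcongr
          exact abs_drift_le hlam0 hb hl g n
      _ = _ := by ring
  · have h : lyap l (g + 1) n - lyap l g n ≤ 15 * V ^ 3 := by
      refine le_trans (le_of_eq ?_) (hstep ((g : ℝ) + n) (by positivity) hsV)
      unfold lyap; push_cast; ring
    rw [abs_of_nonneg (sub_nonneg.2 (lyap_le_lyap_arrival l g n))]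
    calc l * (lyap l (g + 1) n - lyap l g n) ≤ V * (15 * V ^ 3) := by
          gcongr
          exact sub_nonneg.2 (lyap_le_lyap_arrival l g n)
      _ = _ := by ring
  · rcases Nat.eq_zero_or_pos g with rfl | hg
    · simp only [Nat.cast_zero, mul_zero, zero_mul]; positivity
    obtain ⟨g, rfl⟩ := Nat.exists_eq_succ_of_ne_zero hg.ne'
    have h : |lyap l (g + 1 - 1) n - lyap l (g + 1) n| ≤ 15 * V ^ 3 := by
      rw [abs_sub_comm, Nat.add_sub_cancel,
        abs_of_nonneg (sub_nonneg.2 (lyap_le_lyap_arrival l g n))]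
      refine le_trans (le_of_eq ?_) (hstep ((g : ℝ) + n) (by positivity) ?_)
      · unfold lyap; push_cast; ring
      · push_cast at hsV; linarith
    calc d * ((g + 1 : ℕ) : ℝ) * |lyap l (g + 1 - 1) n - lyap l (g + 1) n|
        ≤ d * V * (15 * V ^ 3) := by gcongr
      _ = _ := by ring
  · rcases Nat.eq_zero_or_pos g with rfl | hg
    · simp only [Nat.cast_zero, mul_zero, zero_mul]; positivity
    have h : lyap (l + a) (g - 1) (n + 1) - lyap l g n ≤ A * V ^ 3 := by
      have h1 : l ^ 2 ≤ V ^ 3 :=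
        (pow_le_pow_left₀ hl hlV 2).trans (pow_le_pow_right₀ hV1 (by simp))
      have h2 : l ^ 3 ≤ V ^ 3 := pow_le_pow_left₀ hl hlV 3
      have h3 : l ≤ V ^ 3 := hlV.trans (le_self_pow₀ hV1 (by simp))
      have h4 : 1 ≤ V ^ 3 := one_le_pow₀ hV1
      have h5 : lyap (l + a) (g - 1) (n + 1) - lyap l g n
          = 4 * a * l ^ 3 + 6 * a ^ 2 * l ^ 2 + 4 * a ^ 3 * l + a ^ 4 * 1 := by
        unfold lyap
        rw [Nat.cast_sub hg]
        push_cast; ring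
      have h6 : A * V ^ 3 = 4 * a * V ^ 3 + 6 * a ^ 2 * V ^ 3 + 4 * a ^ 3 * V ^ 3 + a ^ 4 * V ^ 3 :=
        by rw [hA]; ring
      rw [h5, h6]
      gcongr
    have h0 := sub_nonneg.2 (lyap_le_lyap_execution hl ha g n)
    rw [abs_of_nonneg h0]
    calc c * g * (lyap (l + a) (g - 1) (n + 1) - lyap l g n) ≤ c * V * (A * V ^ 3) := by gcongr
      _ = _ := by ring

/-! ### Truncations of the Lyapunov function and of functions of quadratic growth -/

/-- The bounded truncation `k * lyap / (k + lyap)` of the Lyapunov function. -/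
def truncLyap (k : ℝ) (l : ℝ) (g n : ℕ) : ℝ := lyap l g n * cutoff k l g n

lemma add_lyap_pos {k : ℝ} (hk : 0 < k) (l : ℝ) (g n : ℕ) : 0 < k + lyap l g n := by
  linarith [one_le_lyap l g n]

lemma cutoff_pos {k : ℝ} (hk : 0 < k) (l : ℝ) (g n : ℕ) : 0 < cutoff k l g n :=
  div_pos hk (add_lyap_pos hk l g n)

lemma cutoff_le_one {k : ℝ} (hk : 0 < k) (l : ℝ) (g n : ℕ) : cutoff k l g n ≤ 1 := by
  unfold cutoff
  rw [div_le_one (add_lyap_pos hk l g n)]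
  linarith [one_le_lyap l g n]

lemma truncLyap_le {k : ℝ} (hk : 0 < k) (l : ℝ) (g n : ℕ) : truncLyap k l g n ≤ k := by
  unfold truncLyap cutoff
  rw [mul_div_assoc', div_le_iff₀ (add_lyap_pos hk l g n)]
  nlinarith [one_le_lyap l g n]

lemma truncLyap_le_lyap {k : ℝ} (hk : 0 < k) (l : ℝ) (g n : ℕ) :
    truncLyap k l g n ≤ lyap l g n :=
  mul_le_of_le_one_right (by linarith [one_le_lyap l g n]) (cutoff_le_one hk l g n)

lemma truncLyap_nonneg {k : ℝ} (hk : 0 < k) (l : ℝ) (g n : ℕ) : 0 ≤ truncLyap k l g n :=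
  mul_nonneg (by linarith [one_le_lyap l g n]) (cutoff_pos hk l g n).le

lemma cutoff_le_mul_of_lyap_le {k K l l' : ℝ} {g g' n n' : ℕ} (hk : 0 < k) (hK : 1 ≤ K)
    (h : lyap l g n ≤ K * lyap l' g' n') : cutoff k l' g' n' ≤ K * cutoff k l g n := by
  unfold cutoff
  rw [mul_div_assoc', div_le_div_iff₀ (add_lyap_pos hk _ _ _) (add_lyap_pos hk _ _ _)]
  have h1 : k + lyap l g n ≤ K * (k + lyap l' g' n') := by nlinarith
  calc k * (k + lyap l g n) ≤ k * (K * (k + lyap l' g' n')) := by gcongr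
    _ = _ := by ring

lemma hasDerivAt_cutoff {k : ℝ} (hk : 0 < k) (l : ℝ) (g n : ℕ) :
    HasDerivAt (fun x => cutoff k x g n) (-(k * (4 * l ^ 3)) / (k + lyap l g n) ^ 2) l := by
  unfold cutoff
  have h := (hasDerivAt_const l k).div ((hasDerivAt_lyap l g n).const_add k)
    (add_lyap_pos hk l g n).ne'
  exact h.congr_deriv (by ring)

lemma contDiff_cutoff {k : ℝ} (hk : 0 < k) (g n : ℕ) :
    ContDiff ℝ 1 (fun l => cutoff k l g n) := by
  unfold cutoff
  exact contDiff_const.div (contDiff_const.add (contDiff_lyap g n))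
    fun l => (add_lyap_pos hk l g n).ne'

lemma hasDerivAt_truncLyap {k : ℝ} (hk : 0 < k) (l : ℝ) (g n : ℕ) :
    HasDerivAt (fun x => truncLyap k x g n) (4 * l ^ 3 * cutoff k l g n ^ 2) l := by
  have h := (hasDerivAt_lyap l g n).mul (hasDerivAt_cutoff hk l g n)
  refine h.congr_deriv ?_
  have h0 := (add_lyap_pos hk l g n).ne'
  unfold cutoff
  field_simp
  ring

/-- The truncation is a function of the Lyapunov function with difference quotients `w w'`, where
`w` and `w'` are the values of the cutoff; one factor turns a bound by `lyap` into one by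
`truncLyap`. -/
lemma truncLyap_sub {k : ℝ} (hk : 0 < k) (l l' : ℝ) (g g' n n' : ℕ) :
    truncLyap k l' g' n' - truncLyap k l g n
      = (lyap l' g' n' - lyap l g n) * (cutoff k l g n * cutoff k l' g' n') := by
  have h0 := (add_lyap_pos hk l g n).ne'
  have h1 := (add_lyap_pos hk l' g' n').ne'
  unfold truncLyap cutoff
  field_simp
  ring

/-- The generator maps the truncated Lyapunov functions to functions that are bounded by a multiple
of them, uniformly in the level of truncation. -/
lemma exists_generator_truncLyap_le {lam0 a b c d : ℝ} (hlam0 : 0 ≤ lam0) (ha : 0 ≤ a)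
    (hb : 0 ≤ b) (hc : 0 ≤ c) (hd : 0 ≤ d) :
    ∃ C : ℝ, 0 ≤ C ∧ ∀ (k l : ℝ) (g n : ℕ), 0 < k → 0 ≤ l →
      |generator lam0 a b c d (truncLyap k) l g n| ≤ C * truncLyap k l g n := by
  obtain ⟨C, hC0, hC⟩ := exists_lyap_increment_le (lam0 := lam0) hlam0 ha hb hc hd
  refine ⟨4 * C, by positivity, fun k l g n hk hl => ?_⟩
  obtain ⟨h1, h2, h3, h4⟩ := hC l g n hl
  refine (abs_generator_le hc hd _ hl g n).trans ?_
  have hw := cutoff_pos hk l g n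
  have key : ∀ {r D w : ℝ}, 0 ≤ r → r * |D| ≤ C * lyap l g n → 0 < w → w ≤ 1 →
      r * |D * (cutoff k l g n * w)| ≤ C * truncLyap k l g n := by
    intro r D w hr h hw0 hw1
    rw [abs_mul, abs_of_pos (mul_pos hw hw0)]
    calc r * (|D| * (cutoff k l g n * w)) = (r * |D|) * cutoff k l g n * w := by ring
      _ ≤ (r * |D|) * cutoff k l g n * 1 := by gcongr
      _ ≤ (C * lyap l g n) * cutoff k l g n * 1 := by gcongr
      _ = _ := by unfold truncLyap; ring
  rw [(hasDerivAt_truncLyap hk l g n).deriv, truncLyap_sub hk, truncLyap_sub hk, truncLyap_sub hk,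
    pow_two]
  have k1 := key (abs_nonneg _) h1 hw (cutoff_le_one hk l g n)
  have k2 := key hl h2 (cutoff_pos hk l (g + 1) n) (cutoff_le_one hk l (g + 1) n)
  have k3 := key (by positivity) h3 (cutoff_pos hk l (g - 1) n) (cutoff_le_one hk l (g - 1) n)
  have k4 := key (by positivity) h4 (cutoff_pos hk (l + a) (g - 1) (n + 1))
    (cutoff_le_one hk (l + a) (g - 1) (n + 1))
  linarith

lemma isTestFunction_truncLyap {lam0 a b c d : ℝ} (hlam0 : 0 ≤ lam0) (ha : 0 ≤ a)
    (hb : 0 ≤ b) (hc : 0 ≤ c) (hd : 0 ≤ d) {k : ℝ} (hk : 0 < k) :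
    IsTestFunction lam0 a b c d (truncLyap k) := by
  obtain ⟨C, hC0, hC⟩ := exists_generator_truncLyap_le (lam0 := lam0) hlam0 ha hb hc hd
  refine ⟨fun g n => (contDiff_lyap g n).mul (contDiff_cutoff hk g n), ⟨k, fun x => ?_⟩,
    ⟨C * k, fun x => ?_⟩⟩
  · rw [abs_of_nonneg (truncLyap_nonneg hk _ _ _)]
    exact truncLyap_le hk _ _ _
  · refine (hC k _ _ _ hk x.1.2).trans ?_
    gcongr
    exact truncLyap_le hk _ _ _

/-- A function that is continuously differentiable in the intensity and that grows on the state
space, together with its derivative in the intensity, at most quadratically in the size of the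
state. -/
structure HasQuadraticGrowth (p : ℝ → ℕ → ℕ → ℝ) : Prop where
  contDiff : ∀ g n, ContDiff ℝ 1 (fun l => p l g n)
  bound : ∃ K : ℝ, 0 ≤ K ∧ ∀ (l : ℝ) (g n : ℕ), 0 ≤ l → |p l g n| ≤ K * size l g n ^ 2 ∧
    |deriv (fun x => p x g n) l| ≤ K * size l g n ^ 2

/-- For `p` of quadratic growth, the generator maps `p` cut off at level `k` to functions that are
bounded for each `k`, and dominated by the Lyapunov function uniformly in `k`. -/
lemma HasQuadraticGrowth.exists_generator_mul_cutoff_le {lam0 a b c d : ℝ} (hlam0 : 0 ≤ lam0)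
    (ha : 0 ≤ a) (hb : 0 ≤ b) (hc : 0 ≤ c) (hd : 0 ≤ d) {p : ℝ → ℕ → ℕ → ℝ}
    (hp : HasQuadraticGrowth p) :
    ∃ C : ℝ, 0 ≤ C ∧ ∀ (k l : ℝ) (g n : ℕ), 0 < k → 0 ≤ l →
      |generator lam0 a b c d (fun l g n => p l g n * cutoff k l g n) l g n|
        ≤ C * truncLyap k l g n := by
  obtain ⟨C, hC0, hC⟩ := exists_lyap_increment_le (lam0 := lam0) hlam0 ha hb hc hd
  obtain ⟨K, hK0, hK⟩ := hp.bound
  set C1 := b * (lam0 + 1) * K * 27 + K * 27 * C with hC1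
  set C2 := 5 * K * 27 with hC2
  set C3 := d * (17 * K) * 27 with hC3
  set C4 := c * (((2 + a) ^ 2 + 1) * K) * 27 with hC4
  refine ⟨C1 + C2 + C3 + C4, by positivity, fun k l g n hk hl => ?_⟩
  refine (abs_generator_le hc hd _ hl g n).trans ?_
  have hw := cutoff_pos hk l g n
  have hlV := le_size (l := l) g n
  have hgV := natCast_le_size hl g n
  have h3Q := size_pow_le hl g n (m := 3) (by simp)
  have h2Q := size_pow_le hl g n (m := 2) (by simp)
  obtain ⟨hp0, hp1⟩ := hK l g n hl
  have hV0 : 0 ≤ size l g n := by linarith [one_le_size hl g n]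
  have hQ0 : 0 ≤ lyap l g n := by linarith [one_le_lyap l g n]
  -- a jump to a state of comparable size, with a rate of the order of the size
  have jump : ∀ {r R A B l' : ℝ} {g' n' : ℕ}, 0 ≤ r → r ≤ R * size l g n → 0 ≤ R → 0 ≤ l' →
      size l' g' n' ^ 2 ≤ A * size l g n ^ 2 → 0 ≤ A → 1 ≤ B →
      lyap l g n ≤ B * lyap l' g' n' →
      r * |p l' g' n' * cutoff k l' g' n' - p l g n * cutoff k l g n|
        ≤ R * ((A * B + 1) * K) * 27 * truncLyap k l g n := by
    intro r R A B l' g' n' hr hrR hR hl' hA hA0 hB hlyap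
    have hw' := cutoff_pos hk l' g' n'
    have hww := cutoff_le_mul_of_lyap_le hk hB hlyap
    have e1 : |p l' g' n' * cutoff k l' g' n' - p l g n * cutoff k l g n|
        ≤ (A * B + 1) * K * size l g n ^ 2 * cutoff k l g n := by
      refine (abs_sub _ _).trans ?_
      rw [abs_mul, abs_mul, abs_of_pos hw, abs_of_pos hw']
      calc |p l' g' n'| * cutoff k l' g' n' + |p l g n| * cutoff k l g n
          ≤ (K * (A * size l g n ^ 2)) * (B * cutoff k l g n)
            + K * size l g n ^ 2 * cutoff k l g n := by
            gcongr
            exact ((hK l' g' n' hl').1).trans (by gcongr)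
        _ = _ := by ring
    calc _ ≤ (R * size l g n) * ((A * B + 1) * K * size l g n ^ 2 * cutoff k l g n) := by gcongr
      _ = R * ((A * B + 1) * K) * (size l g n ^ 3 * cutoff k l g n) := by ring
      _ ≤ R * ((A * B + 1) * K) * ((27 * lyap l g n) * cutoff k l g n) := by gcongr
      _ = _ := by unfold truncLyap; ring
  have j2 := jump (R := 1) (A := 4) (B := 1) (l' := l) (g' := g + 1) (n' := n) hl (by linarith)
    (by simp) hl
    ((pow_le_pow_left₀ (by linarith [one_le_size hl (g + 1) n]) (size_arrival_le hl g n) 2).trans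
      (le_of_eq (by ring))) (by simp) le_rfl (by simpa using lyap_le_lyap_arrival l g n)
  have j3 := jump (r := d * g) (R := d) (A := 1) (B := 16) (l' := l) (g' := g - 1) (n' := n)
    (by positivity) (by gcongr) hd hl
    ((pow_le_pow_left₀ (by linarith [one_le_size hl (g - 1) n]) (size_cancel_le g n) 2).trans
      (le_of_eq (by ring))) (by simp) (by simp) (lyap_le_lyap_cancel l g n)
  have j4 := jump (r := c * g) (R := c) (A := (2 + a) ^ 2) (B := 1) (l' := l + a) (g' := g - 1)
    (n' := n + 1) (by positivity) (by gcongr) hc (by positivity)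
    ((pow_le_pow_left₀ (by linarith [one_le_size (add_nonneg hl ha) (g - 1) (n + 1)])
      (size_execution_le hl ha g n) 2).trans (le_of_eq (by ring))) (by positivity) le_rfl
    (by simpa using lyap_le_lyap_execution hl ha g n)
  have hder := ((hp.contDiff g n).differentiable (by simp) l).hasDerivAt.mul
    (hasDerivAt_cutoff hk l g n)
  have j1 : |b * (lam0 - l)| * |deriv (fun x => p x g n * cutoff k x g n) l|
      ≤ C1 * truncLyap k l g n := by
    have hd' : deriv (fun x => p x g n * cutoff k x g n) l = _ := hder.deriv
    have hcut : -(k * (4 * l ^ 3)) / (k + lyap l g n) ^ 2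
        = -((4 * l ^ 3) * (cutoff k l g n * (k + lyap l g n)⁻¹)) := by
      unfold cutoff
      field_simp
    rw [hd', hcut]
    have hinv0 : 0 < (k + lyap l g n)⁻¹ := inv_pos.2 (add_lyap_pos hk l g n)
    set D := deriv (fun x => p x g n) l
    set i := (k + lyap l g n)⁻¹
    have hsplit : |D * cutoff k l g n + p l g n * -((4 * l ^ 3) * (cutoff k l g n * i))|
        ≤ |D| * cutoff k l g n + |p l g n| * (|4 * l ^ 3| * (cutoff k l g n * i)) := by
      refine (abs_add_le _ _).trans (le_of_eq ?_)
      rw [abs_mul, abs_mul (p l g n), abs_neg, abs_mul (4 * l ^ 3), abs_of_pos hw,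
        abs_of_pos (mul_pos hw hinv0)]
    have hpi : |p l g n| * i ≤ K * 27 := by
      rw [← div_eq_mul_inv, div_le_iff₀ (add_lyap_pos hk l g n)]
      calc |p l g n| ≤ K * size l g n ^ 2 := hp0
        _ ≤ K * (27 * lyap l g n) := by gcongr
        _ ≤ K * 27 * (k + lyap l g n) := by rw [← mul_assoc]; gcongr; linarith
    calc _ ≤ |b * (lam0 - l)| * (|D| * cutoff k l g n
            + |p l g n| * (|4 * l ^ 3| * (cutoff k l g n * i))) := by gcongr
      _ = |b * (lam0 - l)| * |D| * cutoff k l g n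
            + (|p l g n| * i) * (|b * (lam0 - l)| * |4 * l ^ 3|) * cutoff k l g n := by ring
      _ ≤ (b * (lam0 + 1) * size l g n) * (K * size l g n ^ 2) * cutoff k l g n
            + (K * 27) * (C * lyap l g n) * cutoff k l g n := by
          refine add_le_add ?_ (mul_le_mul_of_nonneg_right
            (mul_le_mul hpi (hC l g n hl).1 (by positivity) (by positivity)) hw.le)
          gcongr
          exact abs_drift_le hlam0 hb hl g n
      _ = b * (lam0 + 1) * K * size l g n ^ 3 * cutoff k l g n
            + (K * 27) * (C * lyap l g n) * cutoff k l g n := by ring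
      _ ≤ b * (lam0 + 1) * K * (27 * lyap l g n) * cutoff k l g n
            + (K * 27) * (C * lyap l g n) * cutoff k l g n := by gcongr
      _ = _ := by unfold truncLyap; rw [hC1]; ring
  have e2 : (1 : ℝ) * ((4 * 1 + 1) * K) * 27 = C2 := by rw [hC2]; ring
  have e3 : d * ((1 * 16 + 1) * K) * 27 = C3 := by rw [hC3]; ring
  have e4 : c * (((2 + a) ^ 2 * 1 + 1) * K) * 27 = C4 := by rw [hC4]; ring
  rw [e2] at j2
  rw [e3] at j3
  rw [e4] at j4
  linarith

lemma HasQuadraticGrowth.isTestFunction_mul_cutoff {lam0 a b c d : ℝ} (hlam0 : 0 ≤ lam0)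
    (ha : 0 ≤ a) (hb : 0 ≤ b) (hc : 0 ≤ c) (hd : 0 ≤ d) {p : ℝ → ℕ → ℕ → ℝ}
    (hp : HasQuadraticGrowth p) {k : ℝ} (hk : 0 < k) :
    IsTestFunction lam0 a b c d (fun l g n => p l g n * cutoff k l g n) := by
  obtain ⟨C, hC0, hC⟩ := hp.exists_generator_mul_cutoff_le (lam0 := lam0) hlam0 ha hb hc hd
  obtain ⟨K, hK0, hK⟩ := hp.bound
  refine ⟨fun g n => (hp.contDiff g n).mul (contDiff_cutoff hk g n), ⟨K * 27 * k, fun x => ?_⟩,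
    ⟨C * k, fun x => ?_⟩⟩
  · have hw := cutoff_pos hk x.1 x.2.1 x.2.2
    rw [abs_mul, abs_of_pos hw]
    calc _ ≤ (K * size x.1 x.2.1 x.2.2 ^ 2) * cutoff k x.1 x.2.1 x.2.2 := by
          gcongr
          exact (hK _ _ _ x.1.2).1
      _ ≤ (K * (27 * lyap x.1 x.2.1 x.2.2)) * cutoff k x.1 x.2.1 x.2.2 := by
          gcongr
          exact size_pow_le x.1.2 _ _ (by simp)
      _ = K * 27 * truncLyap k x.1 x.2.1 x.2.2 := by unfold truncLyap; ring
      _ ≤ _ := by gcongr; exact truncLyap_le hk _ _ _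
  · refine (hC k _ _ _ hk x.1.2).trans ?_
    gcongr
    exact truncLyap_le hk _ _ _

lemma tendsto_cutoff (l : ℝ) (g n : ℕ) :
    Tendsto (fun k : ℕ => cutoff ((k : ℝ) + 1) l g n) atTop (𝓝 1) := by
  have h1 : Tendsto (fun k : ℕ => (k : ℝ) + 1 + lyap l g n) atTop atTop :=
    tendsto_atTop_add_const_right _ _ (tendsto_atTop_add_const_right _ _ tendsto_natCast_atTop_atTop)
  have h2 : Tendsto (fun k : ℕ => 1 - lyap l g n * ((k : ℝ) + 1 + lyap l g n)⁻¹) atTop (𝓝 1) := by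
    simpa using (h1.inv_tendsto_atTop.const_mul (lyap l g n)).const_sub 1
  refine h2.congr fun k => ?_
  have h0 := (add_lyap_pos (k := (k : ℝ) + 1) (by positivity) l g n).ne'
  unfold cutoff
  field_simp
  ring

lemma tendsto_generator_mul_cutoff {lam0 a b c d : ℝ} {p : ℝ → ℕ → ℕ → ℝ}
    (hp : HasQuadraticGrowth p) (l : ℝ) (g n : ℕ) :
    Tendsto (fun k : ℕ =>
      generator lam0 a b c d (fun l g n => p l g n * cutoff ((k : ℝ) + 1) l g n) l g n) atTop
      (𝓝 (generator lam0 a b c d p l g n)) := by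
  have hpt : ∀ l g n, Tendsto (fun k : ℕ => p l g n * cutoff ((k : ℝ) + 1) l g n) atTop
      (𝓝 (p l g n)) := fun l g n => by
    simpa using (tendsto_cutoff l g n).const_mul (p l g n)
  have hder : Tendsto (fun k : ℕ => deriv (fun x => p x g n * cutoff ((k : ℝ) + 1) x g n) l) atTop
      (𝓝 (deriv (fun x => p x g n) l)) := by
    have h1 : Tendsto (fun k : ℕ => (k : ℝ) + 1 + lyap l g n) atTop atTop :=
      tendsto_atTop_add_const_right _ _
        (tendsto_atTop_add_const_right _ _ tendsto_natCast_atTop_atTop)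
    have h2 : Tendsto (fun k : ℕ => deriv (fun x => p x g n) l * cutoff ((k : ℝ) + 1) l g n
        + p l g n * -(4 * l ^ 3 * (cutoff ((k : ℝ) + 1) l g n * ((k : ℝ) + 1 + lyap l g n)⁻¹)))
        atTop (𝓝 (deriv (fun x => p x g n) l * 1 + p l g n * -(4 * l ^ 3 * (1 * 0)))) :=
      ((tendsto_cutoff l g n).const_mul _).add
        ((((tendsto_cutoff l g n).mul h1.inv_tendsto_atTop).const_mul _).neg.const_mul _)
    simp only [mul_one, mul_zero, neg_zero, add_zero] at h2
    refine h2.congr fun k => ?_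
    have hk : (0 : ℝ) < (k : ℝ) + 1 := by positivity
    have h := (((hp.contDiff g n).differentiable (by simp) l).hasDerivAt.mul
      (hasDerivAt_cutoff hk l g n)).deriv
    refine Eq.trans ?_ h.symm
    have h0 := (add_lyap_pos hk l g n).ne'
    unfold cutoff
    field_simp
  unfold generator
  exact (((hder.const_mul _).add (((hpt _ _ _).sub (hpt _ _ _)).const_mul _)).add
    (((hpt _ _ _).sub (hpt _ _ _)).const_mul _)).add (((hpt _ _ _).sub (hpt _ _ _)).const_mul _)

lemma tendsto_truncLyap (l : ℝ) (g n : ℕ) :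
    Tendsto (fun k : ℕ => truncLyap ((k : ℝ) + 1) l g n) atTop (𝓝 (lyap l g n)) := by
  simpa [truncLyap] using (tendsto_cutoff l g n).const_mul (lyap l g n)

/-! ### Integral inequalities -/

/-- Gronwall's inequality in integral form. -/
lemma le_mul_exp_of_le_add_integral {y : ℝ → ℝ} {A C : ℝ} (hC : 0 ≤ C) (hy : Continuous y)
    (h : ∀ t, 0 ≤ t → y t ≤ A + C * ∫ s in (0 : ℝ)..t, y s) {t : ℝ} (ht : 0 ≤ t) :
    y t ≤ A * Real.exp (C * t) := by
  have hder : ∀ t, HasDerivAt (fun t => Real.exp (-(C * t)) * (A + C * ∫ s in (0 : ℝ)..t, y s))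
      (Real.exp (-(C * t)) * (C * (y t - (A + C * ∫ s in (0 : ℝ)..t, y s)))) t := by
    intro t
    have h1 : HasDerivAt (fun t => ∫ s in (0 : ℝ)..t, y s) (y t) t :=
      intervalIntegral.integral_hasDerivAt_right (hy.intervalIntegrable _ _)
        (hy.stronglyMeasurableAtFilter _ _) hy.continuousAt
    have h2 : HasDerivAt (fun t => Real.exp (-(C * t))) (Real.exp (-(C * t)) * -C) t := by
      simpa using ((hasDerivAt_id t).const_mul C).neg.exp
    exact (h2.mul ((h1.const_mul C).const_add A)).congr_deriv (by ring)
  have hanti : AntitoneOn (fun t => Real.exp (-(C * t)) * (A + C * ∫ s in (0 : ℝ)..t, y s))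
      (Set.Ici 0) := by
    refine antitoneOn_of_deriv_nonpos (convex_Ici 0)
      (fun t _ => (hder t).continuousAt.continuousWithinAt)
      (fun t _ => (hder t).differentiableAt.differentiableWithinAt) fun t ht => ?_
    rw [interior_Ici] at ht
    rw [(hder t).deriv]
    have := h t (le_of_lt ht)
    exact mul_nonpos_of_nonneg_of_nonpos (Real.exp_nonneg _)
      (mul_nonpos_of_nonneg_of_nonpos hC (by linarith))
  have h0 := hanti (Set.mem_Ici.2 le_rfl) (Set.mem_Ici.2 ht) ht
  simp only [mul_zero, neg_zero, Real.exp_zero, intervalIntegral.integral_same, add_zero,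
    one_mul] at h0
  rw [Real.exp_neg, inv_mul_le_iff₀ (Real.exp_pos _)] at h0
  linarith [h t ht]

/-- A function whose increments are bounded by the integral of `C - ε y` does not increase while it
is above the level `C / ε`. -/
lemma le_max_of_sub_le_integral {y : ℝ → ℝ} {C ε : ℝ} (hε : 0 < ε) (hy : Continuous y)
    (h : ∀ s t, 0 ≤ s → s ≤ t → y t - y s ≤ ∫ r in s..t, (C - ε * y r)) {t : ℝ} (ht : 0 ≤ t) :
    y t ≤ max (y 0) (C / ε) := by
  by_contra! hlt
  set M := max (y 0) (C / ε)
  set S := Set.Icc 0 t ∩ {s | y s ≤ M}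
  have hS : IsCompact S := isCompact_Icc.inter_right (isClosed_le hy continuous_const)
  -- the last time before `t` at which `y` does not exceed the level
  obtain ⟨s, hsS, hs⟩ := hS.exists_isGreatest 
    ⟨0, ⟨le_rfl, ht⟩, le_max_left (y 0) (C / ε)⟩
  have hneg : ∫ r in s..t, (C - ε * y r) ≤ 0 := by
    rw [intervalIntegral.integral_of_le hsS.1.2]
    refine setIntegral_nonpos measurableSet_Ioc fun r hr => ?_
    have hrM : M < y r := by
      by_contra! hle
      exact absurd (hs ⟨⟨hsS.1.1.trans hr.1.le, hr.2⟩, hle⟩) (not_le.2 hr.1)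
    have h1 : C / ε < y r := (le_max_right _ _).trans_lt hrM
    rw [div_lt_iff₀ hε] at h1
    linarith
  have h1 := h s t hsS.1.1 hsS.1.2
  have h2 : y s ≤ M := hsS.2
  linarith

lemma continuous_of_eq_add_integral {y G : ℝ → ℝ} {A : ℝ}
    (hG : ∀ u v, IntervalIntegrable G volume u v) (hneg : ∀ t, y t = y (max t 0))
    (h : ∀ t, 0 ≤ t → y t = A + ∫ s in (0 : ℝ)..t, G s) : Continuous y := by
  have h1 : y = fun t => A + ∫ s in (0 : ℝ)..(max t 0), G s := by
    ext t
    rw [hneg, h _ (le_max_right _ _)]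
  rw [h1]
  exact continuous_const.add ((intervalIntegral.continuous_primitive hG 0).comp
    (continuous_id.max continuous_const))

/-! ### Moments, and Dynkin's formula for functions of quadratic growth -/

lemma onState_truncLyap_nonneg {k : ℝ} (hk : 0 < k) (x : State) :
    0 ≤ onState (truncLyap k) x :=
  truncLyap_nonneg hk _ _ _

lemma measurable_onState_lyap : Measurable (onState lyap) :=
  measurable_onState fun g n => (contDiff_lyap g n).continuous.measurable

lemma HasQuadraticGrowth.measurable {p : ℝ → ℕ → ℕ → ℝ} (hp : HasQuadraticGrowth p) :
    Measurable (onState p) :=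
  measurable_onState fun g n => (hp.contDiff g n).continuous.measurable

lemma HasQuadraticGrowth.measurable_generator {lam0 a b c d : ℝ} {p : ℝ → ℕ → ℕ → ℝ}
    (hp : HasQuadraticGrowth p) : Measurable (onState (generator lam0 a b c d p)) :=
  measurable_onState (BufferHawkes.measurable_generator
    fun g n => (hp.contDiff g n).continuous.measurable)

lemma HasQuadraticGrowth.exists_le_lyap {p : ℝ → ℕ → ℕ → ℝ} (hp : HasQuadraticGrowth p) :
    ∃ C : ℝ, 0 ≤ C ∧ ∀ x : State, |onState p x| ≤ C * onState lyap x := by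
  obtain ⟨K, hK0, hK⟩ := hp.bound
  refine ⟨K * 27, by positivity, fun x => (hK _ _ _ x.1.2).1.trans ?_⟩
  rw [mul_assoc]
  gcongr
  exact size_pow_le x.1.2 _ _ (by simp)

section Moments

variable {Ω : Type*} {mΩ : MeasurableSpace Ω} {μ : Measure Ω}
  {ℱ : Filtration ℝ≥0 mΩ} {lam0 a b c d : ℝ} {X : ℝ≥0 → Ω → State}

/-- What the truncation arguments give for a function of quadratic growth: integrability of the
function and of its image under the generator, and Dynkin's formula. -/
structure SatisfiesDynkin (lam0 a b c d : ℝ) (μ : Measure Ω) (X : ℝ≥0 → Ω → State)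
    (p : ℝ → ℕ → ℕ → ℝ) : Prop where
  integrable : ∀ t : ℝ≥0, Integrable (fun ω => onState p (X t ω)) μ
  integrable_generator : ∀ t : ℝ≥0,
    Integrable (fun ω => onState (generator lam0 a b c d p) (X t ω)) μ
  intervalIntegrable : ∀ u v : ℝ, IntervalIntegrable (fun s : ℝ =>
    ∫ ω, onState (generator lam0 a b c d p) (X s.toNNReal ω) ∂μ) volume u v
  formula : ∀ t : ℝ, 0 ≤ t → ∫ ω, onState p (X t.toNNReal ω) ∂μ = p lam0 0 0
    + ∫ s in (0 : ℝ)..t, ∫ ω, onState (generator lam0 a b c d p) (X s.toNNReal ω) ∂μ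

lemma SatisfiesDynkin.continuous {p : ℝ → ℕ → ℕ → ℝ} (h : SatisfiesDynkin lam0 a b c d μ X p) :
    Continuous fun s : ℝ => ∫ ω, onState p (X s.toNNReal ω) ∂μ :=
  continuous_of_eq_add_integral h.intervalIntegrable
    (fun t => by rw [← Real.coe_toNNReal', Real.toNNReal_coe]) h.formula

variable [IsProbabilityMeasure μ]

/-- The bound does not depend on the level of truncation `k`. -/
lemma IsBufferHawkes.exists_integral_truncLyap_le (hX : IsBufferHawkes lam0 a b c d μ ℱ X)
    (hlam0 : 0 ≤ lam0) (ha : 0 ≤ a) (hb : 0 ≤ b) (hc : 0 ≤ c) (hd : 0 ≤ d) :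
    ∃ C : ℝ, 0 ≤ C ∧ ∀ (k : ℝ) (t : ℝ≥0), 0 < k →
      ∫ ω, onState (truncLyap k) (X t ω) ∂μ ≤ lyap lam0 0 0 * Real.exp (C * t) := by
  obtain ⟨C, hC0, hC⟩ := exists_generator_truncLyap_le (lam0 := lam0) hlam0 ha hb hc hd
  refine ⟨C, hC0, fun k t hk => ?_⟩
  have htest := isTestFunction_truncLyap (lam0 := lam0) hlam0 ha hb hc hd hk
  have hm : Measurable (onState (truncLyap k)) :=
    measurable_onState fun g n => (htest.contDiff g n).continuous.measurable
  have hm' : Measurable (onState (generator lam0 a b c d (truncLyap k))) :=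
    measurable_onState (measurable_generator fun g n => (htest.contDiff g n).continuous.measurable)
  set y : ℝ → ℝ := fun s => ∫ ω, onState (truncLyap k) (X s.toNNReal ω) ∂μ with hy
  set G : ℝ → ℝ := fun s => ∫ ω, onState (generator lam0 a b c d (truncLyap k))
    (X s.toNNReal ω) ∂μ with hG
  have hbd : ∀ x, |onState (truncLyap k) x| ≤ k := fun x =>
    (abs_of_nonneg (onState_truncLyap_nonneg hk x)).trans_le (truncLyap_le hk _ _ _)
  have hbd' : ∀ x, |onState (generator lam0 a b c d (truncLyap k)) x| ≤ C * k := fun x =>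
    (hC k _ _ _ hk x.1.2).trans (mul_le_mul_of_nonneg_left (truncLyap_le hk _ _ _) hC0)
  have hGi : ∀ u v, IntervalIntegrable G volume u v := fun u v => by
    refine (intervalIntegrable_const (c := C * k)).mono_fun
      (hX.stronglyMeasurable_expectation hm').aestronglyMeasurable (.of_forall fun s => ?_)
    rw [Real.norm_of_nonneg (by positivity : 0 ≤ C * k)]
    refine (norm_integral_le_of_norm_le_const (.of_forall fun ω => hbd' _)).trans ?_
    simp
  have hdyn : ∀ t, 0 ≤ t → y t = truncLyap k lam0 0 0 + ∫ s in (0 : ℝ)..t, G s := by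
    intro t ht
    have h := hX.dynkin_of_isTestFunction htest t.toNNReal
    rwa [Real.coe_toNNReal t ht] at h
  have hyc : Continuous y := continuous_of_eq_add_integral hGi
    (fun t => by simp only [hy]; rw [← Real.coe_toNNReal', Real.toNNReal_coe]) hdyn
  have hGy : ∀ s, G s ≤ C * y s := by
    intro s
    rw [hy, hG, ← integral_const_mul]
    refine integral_mono (integrable_of_bounded hm' hbd' (hX.measurable _))
      ((integrable_of_bounded hm hbd (hX.measurable _)).const_mul _) fun ω => ?_
    exact (le_abs_self _).trans (hC k _ _ _ hk (X s.toNNReal ω).1.2)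
  have h := le_mul_exp_of_le_add_integral (A := truncLyap k lam0 0 0) hC0 hyc (fun t ht => ?_)
    t.2
  · simp only [hy, NNReal.val_eq_coe, Real.toNNReal_coe] at h
    refine h.trans ?_
    gcongr
    exact truncLyap_le_lyap hk _ _ _
  · rw [hdyn t ht, ← intervalIntegral.integral_const_mul]
    gcongr
    exact intervalIntegral.integral_mono_on ht (hGi _ _)
      ((hyc.const_mul C).intervalIntegrable _ _) fun s _ => hGy s

/-- The quartic Lyapunov function has finite expectation, which grows at most exponentially. -/
lemma IsBufferHawkes.exists_integral_lyap_le (hX : IsBufferHawkes lam0 a b c d μ ℱ X)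
    (hlam0 : 0 ≤ lam0) (ha : 0 ≤ a) (hb : 0 ≤ b) (hc : 0 ≤ c) (hd : 0 ≤ d) :
    ∃ C : ℝ, 0 ≤ C ∧ ∀ t : ℝ≥0, Integrable (fun ω => onState lyap (X t ω)) μ ∧
      ∫ ω, onState lyap (X t ω) ∂μ ≤ lyap lam0 0 0 * Real.exp (C * t) := by
  obtain ⟨C, hC0, hC⟩ := hX.exists_integral_truncLyap_le hlam0 ha hb hc hd
  refine ⟨C, hC0, fun t => ?_⟩
  have hkpos : ∀ k : ℕ, (0 : ℝ) < (k : ℝ) + 1 := fun k => by positivity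
  have hm : ∀ k : ℕ, Measurable (fun ω => onState (truncLyap ((k : ℝ) + 1)) (X t ω)) := fun k =>
    (measurable_onState fun g n => ((isTestFunction_truncLyap (lam0 := lam0) hlam0 ha hb hc hd
      (hkpos k)).contDiff g n).continuous.measurable).comp (hX.measurable t)
  have hmQ : Measurable (fun ω => onState lyap (X t ω)) :=
    measurable_onState_lyap.comp (hX.measurable t)
  have hlim : ∀ ω, Tendsto (fun k : ℕ => onState (truncLyap ((k : ℝ) + 1)) (X t ω)) atTop
      (𝓝 (onState lyap (X t ω))) := fun ω => tendsto_truncLyap _ _ _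
  have hint : Integrable (fun ω => onState lyap (X t ω)) μ := by
    refine ⟨hmQ.aestronglyMeasurable, ?_⟩
    have h1 : ∫⁻ ω, ‖onState lyap (X t ω)‖ₑ ∂μ
        ≤ liminf (fun k : ℕ => ∫⁻ ω, ‖onState (truncLyap ((k : ℝ) + 1)) (X t ω)‖ₑ ∂μ) atTop := by
      refine le_trans (le_of_eq (lintegral_congr fun ω => ?_))
        (lintegral_liminf_le fun k => (hm k).enorm)
      exact (hlim ω).enorm.liminf_eq.symm
    refine (h1.trans (liminf_le_of_frequently_le' (.of_forall fun k => ?_))).trans_lt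
      (ENNReal.ofReal_lt_top (r := lyap lam0 0 0 * Real.exp (C * t)))
    have hi : Integrable (fun ω => onState (truncLyap ((k : ℝ) + 1)) (X t ω)) μ :=
      .of_bound (hm k).aestronglyMeasurable ((k : ℝ) + 1) (.of_forall fun ω =>
        (abs_of_nonneg (onState_truncLyap_nonneg (hkpos k) _)).trans_le
          (truncLyap_le (hkpos k) _ _ _))
    have h2 : ∀ ω, ‖onState (truncLyap ((k : ℝ) + 1)) (X t ω)‖ₑ
        = ENNReal.ofReal (onState (truncLyap ((k : ℝ) + 1)) (X t ω)) := fun ω =>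
      Real.enorm_of_nonneg (onState_truncLyap_nonneg (hkpos k) _)
    simp_rw [h2]
    rw [← ofReal_integral_eq_lintegral_ofReal hi
      (.of_forall fun ω => onState_truncLyap_nonneg (hkpos k) _)]
    exact ENNReal.ofReal_le_ofReal (hC _ t (hkpos k))
  refine ⟨hint, ?_⟩
  have htend : Tendsto (fun k : ℕ => ∫ ω, onState (truncLyap ((k : ℝ) + 1)) (X t ω) ∂μ) atTop
      (𝓝 (∫ ω, onState lyap (X t ω) ∂μ)) := by
    refine tendsto_integral_of_dominated_convergence _ (fun k => (hm k).aestronglyMeasurable) hint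
      (fun k => .of_forall fun ω => ?_) (.of_forall hlim)
    exact (abs_of_nonneg (onState_truncLyap_nonneg (hkpos k) _)).trans_le
      (truncLyap_le_lyap (hkpos k) _ _ _)
  exact le_of_tendsto' htend fun k => hC _ t (hkpos k)

/-- Dynkin's formula for functions of quadratic growth. -/
lemma IsBufferHawkes.satisfiesDynkin (hX : IsBufferHawkes lam0 a b c d μ ℱ X)
    (hlam0 : 0 ≤ lam0) (ha : 0 ≤ a) (hb : 0 ≤ b) (hc : 0 ≤ c) (hd : 0 ≤ d)
    {p : ℝ → ℕ → ℕ → ℝ} (hp : HasQuadraticGrowth p) : SatisfiesDynkin lam0 a b c d μ X p := by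
  obtain ⟨Cq, hCq0, hCq⟩ := hX.exists_integral_lyap_le hlam0 ha hb hc hd
  obtain ⟨C1, hC10, hC1⟩ := hp.exists_le_lyap
  obtain ⟨C2, hC20, hC2⟩ := hp.exists_generator_mul_cutoff_le (lam0 := lam0) hlam0 ha hb hc hd
  have hkpos : ∀ k : ℕ, (0 : ℝ) < (k : ℝ) + 1 := fun k => by positivity
  set f : ℕ → ℝ → ℕ → ℕ → ℝ := fun k l g n => p l g n * cutoff ((k : ℝ) + 1) l g n with hf
  have htest : ∀ k, IsTestFunction lam0 a b c d (f k) := fun k =>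
    hp.isTestFunction_mul_cutoff hlam0 ha hb hc hd (hkpos k)
  have hfm : ∀ k, Measurable (onState (f k)) := fun k =>
    measurable_onState fun g n => ((htest k).contDiff g n).continuous.measurable
  have hfm' : ∀ k, Measurable (onState (generator lam0 a b c d (f k))) := fun k =>
    measurable_onState
      (measurable_generator fun g n => ((htest k).contDiff g n).continuous.measurable)
  have hbd : ∀ k x, |onState (f k) x| ≤ C1 * onState lyap x := by
    intro k x
    refine le_trans ?_ (hC1 x)
    have hw := cutoff_pos (hkpos k) x.1 x.2.1 x.2.2
    simp only [onState, hf, abs_mul, abs_of_pos hw]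
    exact mul_le_of_le_one_right (abs_nonneg _) (cutoff_le_one (hkpos k) _ _ _)
  have hbd' : ∀ k x, |onState (generator lam0 a b c d (f k)) x| ≤ C2 * onState lyap x :=
    fun k x => (hC2 _ _ _ _ (hkpos k) x.1.2).trans
      (mul_le_mul_of_nonneg_left (truncLyap_le_lyap (hkpos k) _ _ _) hC20)
  have hlim : ∀ x, Tendsto (fun k => onState (f k) x) atTop (𝓝 (onState p x)) := fun x => by
    simpa [onState, hf] using (tendsto_cutoff x.1 x.2.1 x.2.2).const_mul (p x.1 x.2.1 x.2.2)
  have hlim' : ∀ x, Tendsto (fun k => onState (generator lam0 a b c d (f k)) x) atTop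
      (𝓝 (onState (generator lam0 a b c d p) x)) := fun x => tendsto_generator_mul_cutoff hp _ _ _
  have hbdp : ∀ x, |onState (generator lam0 a b c d p) x| ≤ C2 * onState lyap x := fun x =>
    le_of_tendsto' (hlim' x).abs fun k => hbd' k x
  have hE : ∀ {F : State → ℝ}, (∀ x, |F x| ≤ C2 * onState lyap x) → ∀ s : ℝ,
      ‖∫ ω, F (X s.toNNReal ω) ∂μ‖ ≤ C2 * (lyap lam0 0 0 * Real.exp (Cq * max s 0)) := by
    intro F hF s
    refine (norm_integral_le_of_norm_le ((hCq s.toNNReal).1.const_mul C2)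
      (.of_forall fun ω => hF _)).trans ?_
    rw [integral_const_mul]
    exact mul_le_mul_of_nonneg_left (hCq s.toNNReal).2 hC20
  have hBc : Continuous fun s : ℝ => C2 * (lyap lam0 0 0 * Real.exp (Cq * max s 0)) := by fun_prop
  refine ⟨fun t => ?_, fun t => ?_, fun u v => ?_, fun t ht => ?_⟩
  · exact ((hCq t).1.const_mul C1).mono' (hp.measurable.comp (hX.measurable t)).aestronglyMeasurable
      (.of_forall fun ω => hC1 _)
  · exact ((hCq t).1.const_mul C2).mono'
      (hp.measurable_generator.comp (hX.measurable t)).aestronglyMeasurable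
      (.of_forall fun ω => hbdp _)
  · refine (hBc.intervalIntegrable u v).mono_fun
      (hX.stronglyMeasurable_expectation hp.measurable_generator).aestronglyMeasurable
      (.of_forall fun s => ?_)
    exact (hE hbdp s).trans (le_abs_self _)
  · have h1 : Tendsto (fun k => ∫ ω, onState (f k) (X t.toNNReal ω) ∂μ) atTop
        (𝓝 (∫ ω, onState p (X t.toNNReal ω) ∂μ)) :=
      tendsto_integral_of_dominated_convergence _
        (fun k => ((hfm k).comp (hX.measurable _)).aestronglyMeasurable)
        ((hCq t.toNNReal).1.const_mul C1) (fun k => .of_forall fun ω => hbd k _)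
        (.of_forall fun ω => hlim _)
    have h2 : Tendsto (fun k => ∫ s in (0 : ℝ)..t,
        ∫ ω, onState (generator lam0 a b c d (f k)) (X s.toNNReal ω) ∂μ) atTop
        (𝓝 (∫ s in (0 : ℝ)..t, ∫ ω, onState (generator lam0 a b c d p) (X s.toNNReal ω) ∂μ)) := by
      refine intervalIntegral.tendsto_integral_filter_of_dominated_convergence _
        (.of_forall fun k => (hX.stronglyMeasurable_expectation (hfm' k)).aestronglyMeasurable)
        (.of_forall fun k => .of_forall fun s _ => hE (hbd' k) s)
        (hBc.intervalIntegrable _ _) (.of_forall fun s _ => ?_)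
      exact tendsto_integral_of_dominated_convergence _
        (fun k => ((hfm' k).comp (hX.measurable _)).aestronglyMeasurable)
        ((hCq s.toNNReal).1.const_mul C2) (fun k => .of_forall fun ω => hbd' k _)
        (.of_forall fun ω => hlim' _)
    have h3 : Tendsto (fun k => f k lam0 0 0) atTop (𝓝 (p lam0 0 0)) := by
      simpa [hf] using (tendsto_cutoff lam0 0 0).const_mul (p lam0 0 0)
    refine tendsto_nhds_unique h1 ((h3.add h2).congr fun k => ?_)
    have h := hX.dynkin_of_isTestFunction (htest k) t.toNNReal
    rw [Real.coe_toNNReal t ht] at h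
    exact h.symm

end Moments

/-! ### Linear forms and their squares -/

/-- A linear form on the state space. -/
def linForm (α β γ : ℝ) (l : ℝ) (g n : ℕ) : ℝ := α * l + β * g + γ * n

lemma hasDerivAt_linForm (α β γ l : ℝ) (g n : ℕ) :
    HasDerivAt (fun x => linForm α β γ x g n) α l := by
  unfold linForm
  simpa using (((hasDerivAt_id l).const_mul α).add_const (β * (g : ℝ))).add_const (γ * (n : ℝ))

lemma abs_linForm_le (α β γ : ℝ) {l : ℝ} (hl : 0 ≤ l) (g n : ℕ) :
    |linForm α β γ l g n| ≤ (|α| + |β| + |γ|) * size l g n := by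
  have hg : (0 : ℝ) ≤ g := g.cast_nonneg
  have hn : (0 : ℝ) ≤ n := n.cast_nonneg
  have h1 := le_size (l := l) g n
  have h2 := natCast_le_size hl g n
  have h3 : (n : ℝ) ≤ size l g n := by unfold size; linarith
  unfold linForm
  calc |α * l + β * g + γ * n| ≤ |α * l| + |β * g| + |γ * n| := abs_add_three _ _ _
    _ = |α| * l + |β| * g + |γ| * n := by
      rw [abs_mul, abs_mul, abs_mul, abs_of_nonneg hl, abs_of_nonneg hg, abs_of_nonneg hn]
    _ ≤ |α| * size l g n + |β| * size l g n + |γ| * size l g n := by gcongr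
    _ = _ := by ring

lemma hasQuadraticGrowth_linForm (α β γ : ℝ) : HasQuadraticGrowth (linForm α β γ) := by
  refine ⟨fun g n => by unfold linForm; fun_prop, |α| + |β| + |γ|, by positivity,
    fun l g n hl => ?_⟩
  have h1 := one_le_size hl g n
  have h2 : size l g n ≤ size l g n ^ 2 := le_self_pow₀ h1 (by simp)
  refine ⟨(abs_linForm_le α β γ hl g n).trans (by gcongr), ?_⟩
  rw [(hasDerivAt_linForm α β γ l g n).deriv]
  calc |α| ≤ |α| + |β| + |γ| := by linarith [abs_nonneg β, abs_nonneg γ]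
    _ ≤ _ := le_mul_of_one_le_right (by positivity) (h1.trans h2)

lemma hasDerivAt_linForm_sq (α β γ l : ℝ) (g n : ℕ) :
    HasDerivAt (fun x => linForm α β γ x g n ^ 2) (2 * linForm α β γ l g n * α) l := by
  simpa using (hasDerivAt_linForm α β γ l g n).fun_pow 2

lemma hasQuadraticGrowth_linForm_sq (α β γ : ℝ) :
    HasQuadraticGrowth (fun l g n => linForm α β γ l g n ^ 2) := by
  set A := |α| + |β| + |γ| with hA
  have hA0 : 0 ≤ A := by positivity
  refine ⟨fun g n => by unfold linForm; fun_prop, 2 * A ^ 2, by positivity, fun l g n hl => ?_⟩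
  have h1 := one_le_size hl g n
  have h2 : size l g n ≤ size l g n ^ 2 := le_self_pow₀ h1 (by simp)
  have h3 := abs_linForm_le α β γ hl g n
  constructor
  · rw [abs_pow]
    calc |linForm α β γ l g n| ^ 2 ≤ (A * size l g n) ^ 2 := by gcongr
      _ = A ^ 2 * size l g n ^ 2 := by ring
      _ ≤ 2 * A ^ 2 * size l g n ^ 2 := by gcongr; nlinarith
  · rw [(hasDerivAt_linForm_sq α β γ l g n).deriv, abs_mul, abs_mul, abs_two]
    calc 2 * |linForm α β γ l g n| * |α| ≤ 2 * (A * size l g n) * A := by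
          gcongr
          linarith [abs_nonneg β, abs_nonneg γ]
      _ = 2 * A ^ 2 * size l g n := by ring
      _ ≤ 2 * A ^ 2 * size l g n ^ 2 := by gcongr

lemma generator_linForm (lam0 a b c d α β γ l : ℝ) (g n : ℕ) :
    generator lam0 a b c d (linForm α β γ) l g n
      = α * b * lam0 + (β - α * b) * l + (c * (α * a - β + γ) - d * β) * g := by
  unfold generator
  rw [(hasDerivAt_linForm α β γ l g n).deriv]
  unfold linForm
  rcases g with _ | g
  · push_cast; ring
  · rw [Nat.add_sub_cancel]
    push_cast; ring

/-- The generator on the square of a linear form: the chain rule and the squared jumps of the form,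
weighted by their rates. -/
lemma generator_linForm_sq (lam0 a b c d α β γ l : ℝ) (g n : ℕ) :
    generator lam0 a b c d (fun l g n => linForm α β γ l g n ^ 2) l g n
      = 2 * linForm α β γ l g n * generator lam0 a b c d (linForm α β γ) l g n
        + β ^ 2 * l + (d * β ^ 2 + c * (α * a - β + γ) ^ 2) * g := by
  rw [generator_linForm]
  unfold generator
  rw [(hasDerivAt_linForm_sq α β γ l g n).deriv]
  unfold linForm
  rcases g with _ | g
  · push_cast; ring
  · rw [Nat.add_sub_cancel]
    push_cast; ring

/-- The Cauchy–Schwarz inequality for the covariance. -/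
lemma covariance_sq_le {Ω : Type*} {mΩ : MeasurableSpace Ω} {μ : Measure Ω}
    [IsProbabilityMeasure μ] {U V : Ω → ℝ} (hU : MemLp U 2 μ) (hV : MemLp V 2 μ) :
    cov[U, V; μ] ^ 2 ≤ Var[U; μ] * Var[V; μ] := by
  have h : ∀ x : ℝ, 0 ≤ Var[U; μ] * (x * x) + 2 * cov[U, V; μ] * x + Var[V; μ] := by
    intro x
    have h1 := variance_fun_add (hU.const_mul x) hV
    rw [variance_const_mul, covariance_const_mul_left] at h1
    have h2 := variance_nonneg (fun ω => x * U ω + V ω) μ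
    linarith
  have := discrim_le_zero h
  unfold discrim at this
  linarith

lemma integral_linearCombination {E : Type*} {mE : MeasurableSpace E} {ν : Measure E}
    {u v w : E → ℝ} (hu : Integrable u ν) (hv : Integrable v ν) (hw : Integrable w ν)
    (A B C : ℝ) : ∫ x, (A * u x + B * v x + C * w x) ∂ν
      = A * (∫ x, u x ∂ν) + B * (∫ x, v x ∂ν) + C * ∫ x, w x ∂ν := by
  have h1 := integral_add ((hu.const_mul A).add (hv.const_mul B)) (hw.const_mul C)
  have h2 := integral_add (hu.const_mul A) (hv.const_mul B)
  simp only [Pi.add_apply] at h1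
  rw [h1, h2, integral_const_mul, integral_const_mul, integral_const_mul]

lemma intervalIntegral_linearCombination {u v w : ℝ → ℝ} (hu : Continuous u) (hv : Continuous v)
    (hw : Continuous w) (A B C t : ℝ) : ∫ s in (0 : ℝ)..t, (A * u s + B * v s + C * w s)
      = A * (∫ s in (0 : ℝ)..t, u s) + B * (∫ s in (0 : ℝ)..t, v s)
        + C * ∫ s in (0 : ℝ)..t, w s := by
  have hA := (hu.const_mul A).intervalIntegrable (μ := volume) 0 t
  have hB := (hv.const_mul B).intervalIntegrable (μ := volume) 0 t
  have hC := (hw.const_mul C).intervalIntegrable (μ := volume) 0 t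
  have h1 := intervalIntegral.integral_add (hA.add hB) hC
  have h2 := intervalIntegral.integral_add hA hB
  rw [h1, h2, intervalIntegral.integral_const_mul, intervalIntegral.integral_const_mul,
    intervalIntegral.integral_const_mul]

/-! ### First and second moments of linear forms -/

section Variance

variable {Ω : Type*} {mΩ : MeasurableSpace Ω} {μ : Measure Ω}
  {ℱ : Filtration ℝ≥0 mΩ} {lam0 a b c d : ℝ} {X : ℝ≥0 → Ω → State}

/-- The mean intensity, as a function of real time (equal to its initial value at negative times).
-/
def meanIntensity (μ : Measure Ω) (X : ℝ≥0 → Ω → State) (s : ℝ) : ℝ :=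
  ∫ ω, onState (linForm 1 0 0) (X s.toNNReal ω) ∂μ

/-- The mean size of the limit order book, as a function of real time (equal to its initial value at
negative times). -/
def meanBook (μ : Measure Ω) (X : ℝ≥0 → Ω → State) (s : ℝ) : ℝ :=
  ∫ ω, onState (linForm 0 1 0) (X s.toNNReal ω) ∂μ

variable [IsProbabilityMeasure μ]

lemma integral_generator_linForm
    (hL : ∀ t, Integrable (fun ω => onState (linForm 1 0 0) (X t ω)) μ)
    (hG : ∀ t, Integrable (fun ω => onState (linForm 0 1 0) (X t ω)) μ) (α β γ s : ℝ) :
    ∫ ω, onState (generator lam0 a b c d (linForm α β γ)) (X s.toNNReal ω) ∂μ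
      = α * b * lam0 + (β - α * b) * meanIntensity μ X s
        + (c * (α * a - β + γ) - d * β) * meanBook μ X s := by
  have h1 : ∀ ω, onState (generator lam0 a b c d (linForm α β γ)) (X s.toNNReal ω)
      = α * b * lam0 * 1 + (β - α * b) * onState (linForm 1 0 0) (X s.toNNReal ω)
        + (c * (α * a - β + γ) - d * β) * onState (linForm 0 1 0) (X s.toNNReal ω) := by
    intro ω
    simp only [onState, generator_linForm]
    unfold linForm
    ring
  simp_rw [h1]
  rw [integral_linearCombination (integrable_const (1 : ℝ)) (hL _) (hG _)]
  simp [meanIntensity, meanBook]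

/-- If the stability condition holds, a suitable positive combination of intensity and book size has
bounded second moment. -/
lemma IsBufferHawkes.exists_integral_sq_le (hX : IsBufferHawkes lam0 a b c d μ ℱ X)
    (hlam0 : 0 < lam0) (ha : 0 ≤ a) (hb : 0 < b) (hc : 0 < c) (hd : 0 ≤ d)
    (hstab : a * c < b * (c + d)) :
    ∃ ρ M : ℝ, 0 < ρ ∧ ∀ t : ℝ≥0,
      ∫ ω, onState (fun l g n => linForm 1 ρ 0 l g n ^ 2) (X t ω) ∂μ ≤ M := by
  have hcd : 0 < c + d := by positivity
  -- both rates of return to equilibrium are positive for `ρ` strictly between `ac / (c + d)` and `b`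
  obtain ⟨ρ, hρ1, hρ2⟩ := exists_between ((div_lt_iff₀ hcd).2 hstab)
  have hρ0 : 0 < ρ := lt_of_le_of_lt (by positivity) hρ1
  rw [div_lt_iff₀ hcd] at hρ1
  set δ := min (b - ρ) ((ρ * (c + d) - a * c) / ρ) with hδ
  have hδ0 : 0 < δ := lt_min (by linarith) (div_pos (by linarith) hρ0)
  have hδ1 : δ ≤ b - ρ := min_le_left _ _
  have hδ2 : δ * ρ ≤ ρ * (c + d) - a * c := (le_div_iff₀ hρ0).1 (min_le_right _ _)
  set K := ρ ^ 2 + d * ρ + c * (a - ρ) ^ 2 / ρ with hK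
  set B := 2 * (b * lam0) + K with hB
  set q : ℝ → ℕ → ℕ → ℝ := fun l g n => linForm 1 ρ 0 l g n ^ 2 with hq
  have hgen : ∀ x : State, onState (generator lam0 a b c d q) x
      ≤ B ^ 2 / (4 * δ) - δ * onState q x := by
    rintro ⟨l, g, n⟩
    have hl : (0 : ℝ) ≤ l := l.2
    have hg : (0 : ℝ) ≤ g := g.cast_nonneg
    simp only [onState, hq, generator_linForm_sq, generator_linForm]
    have hv : linForm 1 ρ 0 l g n = (l : ℝ) + ρ * g := by unfold linForm; ring
    rw [hv]
    set v := (l : ℝ) + ρ * g with hvdef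
    have hv0 : 0 ≤ v := by positivity
    have h1 : 1 * b * lam0 + (ρ - 1 * b) * l + (c * (1 * a - ρ + 0) - d * ρ) * g
        ≤ b * lam0 - δ * v := by
      have e1 : δ * l ≤ (b - ρ) * l := by gcongr
      have e2 : δ * ρ * g ≤ (ρ * (c + d) - a * c) * g := by gcongr
      rw [hvdef]
      linarith
    have h2 : ρ ^ 2 * l + (d * ρ ^ 2 + c * (1 * a - ρ + 0) ^ 2) * g ≤ K * v := by
      have e1 : K * v = ρ ^ 2 * l + (d * ρ ^ 2 + c * (a - ρ) ^ 2) * g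
          + (d * ρ * l + c * (a - ρ) ^ 2 / ρ * l + ρ ^ 2 * (ρ * g)) := by
        rw [hK, hvdef]
        field_simp
        ring
      have e2 : 0 ≤ d * ρ * l + c * (a - ρ) ^ 2 / ρ * l + ρ ^ 2 * (ρ * g) := by positivity
      rw [e1, one_mul, add_zero]
      linarith
    have h3 : B * v ≤ B ^ 2 / (4 * δ) + δ * v ^ 2 := by
      have e1 : B ^ 2 / (4 * δ) + δ * v ^ 2 - B * v = (B - 2 * δ * v) ^ 2 / (4 * δ) := by
        field_simp
        ring
      have e2 : 0 ≤ (B - 2 * δ * v) ^ 2 / (4 * δ) := by positivity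
      linarith
    have h4 := mul_le_mul_of_nonneg_left h1 (by positivity : 0 ≤ 2 * v)
    have h5 : B * v = 2 * v * (b * lam0) + K * v := by rw [hB]; ring
    linarith
  have hdyn := hX.satisfiesDynkin hlam0.le ha hb.le hc.le hd (hasQuadraticGrowth_linForm_sq 1 ρ 0)
  set y : ℝ → ℝ := fun s => ∫ ω, onState q (X s.toNNReal ω) ∂μ with hy
  have hyc : Continuous y := hdyn.continuous
  refine ⟨ρ, max (y 0) (B ^ 2 / (4 * δ) / δ), hρ0, fun t => ?_⟩
  have h := le_max_of_sub_le_integral (C := B ^ 2 / (4 * δ)) hδ0 hyc (fun s t hs hst => ?_) t.2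
  · simpa [hy] using h
  · have e1 := hdyn.formula s hs
    have e2 := hdyn.formula t (hs.trans hst)
    have e3 := intervalIntegral.integral_add_adjacent_intervals (hdyn.intervalIntegrable 0 s)
      (hdyn.intervalIntegrable s t)
    have e4 : y t - y s = ∫ r in s..t, ∫ ω, onState (generator lam0 a b c d q)
        (X r.toNNReal ω) ∂μ := by
      simp only [hy]
      rw [e1, e2, ← e3]
      ring
    rw [e4]
    refine intervalIntegral.integral_mono_on hst (hdyn.intervalIntegrable s t)
      ((continuous_const.sub (hyc.const_mul δ)).intervalIntegrable _ _) fun r _ => ?_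
    have e5 : B ^ 2 / (4 * δ) - δ * y r
        = ∫ ω, (B ^ 2 / (4 * δ) - δ * onState q (X r.toNNReal ω)) ∂μ := by
      rw [integral_sub (integrable_const _) ((hdyn.integrable _).const_mul _),
        integral_const_mul]
      simp [hy, hq]
    rw [e5]
    exact integral_mono (hdyn.integrable_generator _)
      ((integrable_const _).sub ((hdyn.integrable _).const_mul _)) fun ω => hgen _

lemma IsBufferHawkes.memLp_linForm (hX : IsBufferHawkes lam0 a b c d μ ℱ X)
    (hlam0 : 0 ≤ lam0) (ha : 0 ≤ a) (hb : 0 ≤ b) (hc : 0 ≤ c) (hd : 0 ≤ d) (α β γ : ℝ) (t : ℝ≥0) :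
    MemLp (fun ω => onState (linForm α β γ) (X t ω)) 2 μ := by
  refine (memLp_two_iff_integrable_sq
    ((hasQuadraticGrowth_linForm α β γ).measurable.comp
      (hX.measurable t)).aestronglyMeasurable).2 ?_
  exact (hX.satisfiesDynkin hlam0 ha hb hc hd (hasQuadraticGrowth_linForm_sq α β γ)).integrable t

/-- The second moments of linear forms in intensity and book size are bounded in time. -/
lemma IsBufferHawkes.exists_integral_linForm_sq_le (hX : IsBufferHawkes lam0 a b c d μ ℱ X)
    (hlam0 : 0 < lam0) (ha : 0 ≤ a) (hb : 0 < b) (hc : 0 < c) (hd : 0 ≤ d)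
    (hstab : a * c < b * (c + d)) (α β : ℝ) :
    ∃ M : ℝ, ∀ t : ℝ≥0, ∫ ω, onState (linForm α β 0) (X t ω) ^ 2 ∂μ ≤ M := by
  obtain ⟨ρ, M, hρ, hM⟩ := hX.exists_integral_sq_le hlam0 ha hb hc hd hstab
  set A := |α| + |β| / ρ with hA
  refine ⟨A ^ 2 * M, fun t => ?_⟩
  have h1 := (hX.satisfiesDynkin hlam0.le ha hb.le hc.le hd
    (hasQuadraticGrowth_linForm_sq α β 0)).integrable t
  have h2 := (hX.satisfiesDynkin hlam0.le ha hb.le hc.le hd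
    (hasQuadraticGrowth_linForm_sq 1 ρ 0)).integrable t
  calc ∫ ω, onState (linForm α β 0) (X t ω) ^ 2 ∂μ
      ≤ ∫ ω, A ^ 2 * onState (fun l g n => linForm 1 ρ 0 l g n ^ 2) (X t ω) ∂μ := by
        refine integral_mono h1 (h2.const_mul _) fun ω => ?_
        obtain ⟨l, g, n⟩ := X t ω
        have hl : (0 : ℝ) ≤ l := l.2
        have hg : (0 : ℝ) ≤ g := g.cast_nonneg
        simp only [onState, linForm, zero_mul, add_zero, one_mul]
        rw [← mul_pow]
        refine sq_le_sq.2 ?_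
        rw [abs_of_nonneg (by positivity : 0 ≤ A * ((l : ℝ) + ρ * g))]
        calc |α * l + β * g| ≤ |α| * l + |β| * g := by
              refine (abs_add_le _ _).trans (le_of_eq ?_)
              rw [abs_mul, abs_mul, abs_of_nonneg hl, abs_of_nonneg hg]
          _ ≤ |α| * l + |β| * g + (|α| * (ρ * g) + |β| / ρ * l) :=
              le_add_of_nonneg_right (by positivity)
          _ = A * (l + ρ * g) := by rw [hA]; field_simp; ring
    _ = A ^ 2 * ∫ ω, onState (fun l g n => linForm 1 ρ 0 l g n ^ 2) (X t ω) ∂μ :=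
        integral_const_mul _ _
    _ ≤ A ^ 2 * M := by gcongr; exact hM t

/-- Dynkin's formula for intensity and book size: two linear equations that determine the time
integrals of the two means in terms of their present values. -/
lemma IsBufferHawkes.integral_means (hX : IsBufferHawkes lam0 a b c d μ ℱ X)
    (hlam0 : 0 < lam0) (ha : 0 ≤ a) (hb : 0 < b) (hc : 0 < c) (hd : 0 ≤ d) {t : ℝ} (ht : 0 ≤ t) :
    meanIntensity μ X t = lam0 + b * lam0 * t - b * (∫ s in (0 : ℝ)..t, meanIntensity μ X s)
        + a * c * ∫ s in (0 : ℝ)..t, meanBook μ X s ∧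
    meanBook μ X t = (∫ s in (0 : ℝ)..t, meanIntensity μ X s)
        - (c + d) * ∫ s in (0 : ℝ)..t, meanBook μ X s := by
  have hL := hX.satisfiesDynkin hlam0.le ha hb.le hc.le hd (hasQuadraticGrowth_linForm 1 0 0)
  have hG := hX.satisfiesDynkin hlam0.le ha hb.le hc.le hd (hasQuadraticGrowth_linForm 0 1 0)
  have hLc : Continuous (meanIntensity μ X) := hL.continuous
  have hGc : Continuous (meanBook μ X) := hG.continuous
  have e1 := hL.formula t ht
  have e2 := hG.formula t ht
  simp_rw [integral_generator_linForm hL.integrable hG.integrable] at e1 e2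
  have key : ∀ A B C : ℝ, ∫ s in (0 : ℝ)..t, (A + B * meanIntensity μ X s + C * meanBook μ X s)
      = A * t + B * (∫ s in (0 : ℝ)..t, meanIntensity μ X s)
        + C * ∫ s in (0 : ℝ)..t, meanBook μ X s := fun A B C => by
    simpa using intervalIntegral_linearCombination (continuous_const (y := (1 : ℝ))) hLc hGc A B C t
  rw [key] at e1 e2
  constructor
  · rw [meanIntensity, e1]
    unfold linForm
    push_cast
    ring
  · rw [meanBook, e2]
    unfold linForm
    push_cast
    ring

/-- The linear form `h = (c / D) Λ + (b c / D) Γ + N`, with `D = b (c + d) - a c`, has constant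
image under the generator, so that `h(X_t)` is a martingale up to a deterministic drift; its
variance is the integrated mean of its squared jumps. -/
lemma IsBufferHawkes.variance_linForm (hX : IsBufferHawkes lam0 a b c d μ ℱ X)
    (hlam0 : 0 < lam0) (ha : 0 ≤ a) (hb : 0 < b) (hc : 0 < c) (hd : 0 ≤ d)
    {D : ℝ} (hD : D = b * (c + d) - a * c) (hD0 : 0 < D) (t : ℝ≥0) :
    Var[fun ω => onState (linForm (c / D) (b * c / D) 1) (X t ω); μ]
      = (b * c / D) ^ 2 * (∫ s in (0 : ℝ)..t, meanIntensity μ X s)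
        + (d * (b * c / D) ^ 2 + c * (b * d / D) ^ 2) * ∫ s in (0 : ℝ)..t, meanBook μ X s := by
  set α := c / D with hα
  set β := b * c / D with hβ
  have hjump : α * a - β + 1 = b * d / D := by
    rw [hα, hβ]
    field_simp
    rw [hD]; ring
  have hdrift1 : β - α * b = 0 := by rw [hα, hβ]; ring
  have hdrift2 : c * (α * a - β + 1) - d * β = 0 := by rw [hjump, hβ]; ring
  have hL := hX.satisfiesDynkin hlam0.le ha hb.le hc.le hd (hasQuadraticGrowth_linForm 1 0 0)
  have hG := hX.satisfiesDynkin hlam0.le ha hb.le hc.le hd (hasQuadraticGrowth_linForm 0 1 0)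
  have hH := hX.satisfiesDynkin hlam0.le ha hb.le hc.le hd (hasQuadraticGrowth_linForm α β 1)
  have hH2 := hX.satisfiesDynkin hlam0.le ha hb.le hc.le hd (hasQuadraticGrowth_linForm_sq α β 1)
  have hLc : Continuous (meanIntensity μ X) := hL.continuous
  have hGc : Continuous (meanBook μ X) := hG.continuous
  set κ := α * b * lam0 with hκ
  have hmean : ∀ s : ℝ, 0 ≤ s → ∫ ω, onState (linForm α β 1) (X s.toNNReal ω) ∂μ
      = α * lam0 + κ * s := by
    intro s hs
    have e := hH.formula s hs
    simp_rw [integral_generator_linForm hL.integrable hG.integrable, hdrift1, hdrift2] at e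
    rw [e]
    unfold linForm
    simp only [zero_mul, add_zero, intervalIntegral.integral_const, smul_eq_mul, sub_zero]
    push_cast
    ring
  set J := d * β ^ 2 + c * (b * d / D) ^ 2 with hJ
  have hgen2 : ∀ s : ℝ, ∫ ω, onState (generator lam0 a b c d
      (fun l g n => linForm α β 1 l g n ^ 2)) (X s.toNNReal ω) ∂μ
      = 2 * κ * (∫ ω, onState (linForm α β 1) (X s.toNNReal ω) ∂μ)
        + β ^ 2 * meanIntensity μ X s + J * meanBook μ X s := by
    intro s
    have h1 : ∀ ω, onState (generator lam0 a b c d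
        (fun l g n => linForm α β 1 l g n ^ 2)) (X s.toNNReal ω)
        = 2 * κ * onState (linForm α β 1) (X s.toNNReal ω)
          + β ^ 2 * onState (linForm 1 0 0) (X s.toNNReal ω)
          + J * onState (linForm 0 1 0) (X s.toNNReal ω) := by
      intro ω
      simp only [onState, generator_linForm_sq, generator_linForm, hdrift1, hjump]
      unfold linForm
      ring
    simp_rw [h1]
    rw [integral_linearCombination (hH.integrable _) (hL.integrable _) (hG.integrable _)]
    rfl
  have e := hH2.formula t t.2
  have hint : ∫ s in (0 : ℝ)..t, ∫ ω, onState (generator lam0 a b c d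
      (fun l g n => linForm α β 1 l g n ^ 2)) (X s.toNNReal ω) ∂μ
      = 2 * κ * (α * lam0 * t + κ * ((t : ℝ) ^ 2 / 2))
        + β ^ 2 * (∫ s in (0 : ℝ)..t, meanIntensity μ X s)
        + J * ∫ s in (0 : ℝ)..t, meanBook μ X s := by
    have h1 : ∫ s in (0 : ℝ)..t, ∫ ω, onState (generator lam0 a b c d
        (fun l g n => linForm α β 1 l g n ^ 2)) (X s.toNNReal ω) ∂μ
        = ∫ s in (0 : ℝ)..t, (2 * κ * (α * lam0 + κ * s)
          + β ^ 2 * meanIntensity μ X s + J * meanBook μ X s) := by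
      refine intervalIntegral.integral_congr fun s hs => ?_
      rw [Set.uIcc_of_le t.coe_nonneg] at hs
      simp only [hgen2, hmean s hs.1]
    rw [h1, intervalIntegral_linearCombination (by fun_prop) hLc hGc]
    have h2 : ∫ s in (0 : ℝ)..t, (α * lam0 + κ * s) = α * lam0 * t + κ * ((t : ℝ) ^ 2 / 2) := by
      have h := intervalIntegral_linearCombination (continuous_const (y := (1 : ℝ))) continuous_id
        continuous_const (w := fun _ => 0) (α * lam0) κ 0 t
      simpa using h
    rw [h2]
  have hm := hmean t t.2
  rw [hint] at e
  simp only [Real.toNNReal_coe] at e hm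
  rw [variance_eq_sub (hX.memLp_linForm hlam0.le ha hb.le hc.le hd α β 1 t), hm]
  have e' : ∫ ω, ((fun ω => onState (linForm α β 1) (X t ω)) ^ 2) ω ∂μ = _ := e
  rw [e']
  have h0 : linForm α β 1 lam0 0 0 = α * lam0 := by unfold linForm; push_cast; ring
  rw [h0]
  ring

end Variance

/-! ### Asymptotics of the variance -/

section Asymptotics

variable {Ω : Type*} {mΩ : MeasurableSpace Ω} {μ : Measure Ω} [IsProbabilityMeasure μ]
  {ℱ : Filtration ℝ≥0 mΩ} {lam0 a b c d : ℝ} {X : ℝ≥0 → Ω → State}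

/-- The means of linear forms in intensity and book size are bounded in time. -/
lemma IsBufferHawkes.exists_abs_integral_linForm_le (hX : IsBufferHawkes lam0 a b c d μ ℱ X)
    (hlam0 : 0 < lam0) (ha : 0 ≤ a) (hb : 0 < b) (hc : 0 < c) (hd : 0 ≤ d)
    (hstab : a * c < b * (c + d)) (α β : ℝ) :
    ∃ M : ℝ, ∀ t : ℝ≥0, |∫ ω, onState (linForm α β 0) (X t ω) ∂μ| ≤ M := by
  obtain ⟨M, hM⟩ := hX.exists_integral_linForm_sq_le hlam0 ha hb hc hd hstab α β
  refine ⟨√M, fun t => Real.abs_le_sqrt ?_⟩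
  have h1 := variance_nonneg (fun ω => onState (linForm α β 0) (X t ω)) μ
  rw [variance_eq_sub (hX.memLp_linForm hlam0.le ha hb.le hc.le hd α β 0 t)] at h1
  have h2 : ∫ ω, ((fun ω => onState (linForm α β 0) (X t ω)) ^ 2) ω ∂μ ≤ M := hM t
  linarith

/-- The variance of the martingale part grows linearly, with a bounded error. -/
lemma IsBufferHawkes.exists_abs_variance_linForm_sub_le (hX : IsBufferHawkes lam0 a b c d μ ℱ X)
    (hlam0 : 0 < lam0) (ha : 0 ≤ a) (hb : 0 < b) (hc : 0 < c) (hd : 0 ≤ d)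
    (hstab : a * c < b * (c + d)) {D : ℝ} (hD : D = b * (c + d) - a * c) :
    ∃ R : ℝ, 0 ≤ R ∧ ∀ t : ℝ≥0,
      |Var[fun ω => onState (linForm (c / D) (b * c / D) 1) (X t ω); μ]
        - lam0 * c / (c + d) * (b * (c + d) / D) ^ 3 * t| ≤ R := by
  have hcd : 0 < c + d := by positivity
  have hD0 : 0 < D := by linarith
  obtain ⟨M1, hM1⟩ := hX.exists_abs_integral_linForm_le hlam0 ha hb hc hd hstab 1 0
  obtain ⟨M2, hM2⟩ := hX.exists_abs_integral_linForm_le hlam0 ha hb hc hd hstab 0 1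
  set J := d * (b * c / D) ^ 2 + c * (b * d / D) ^ 2 with hJ
  set S := (b * c / D) ^ 2 * (c + d) + J with hS
  have hS0 : 0 ≤ S := by positivity
  have hM10 : 0 ≤ M1 := (abs_nonneg _).trans (hM1 0)
  have hM20 : 0 ≤ M2 := (abs_nonneg _).trans (hM2 0)
  refine ⟨(b * c / D) ^ 2 * M2 + S / D * (lam0 + M1 + b * M2), by positivity, fun t => ?_⟩
  rw [hX.variance_linForm hlam0 ha hb hc hd hD hD0 t, ← hJ]
  obtain ⟨h1, h2⟩ := hX.integral_means hlam0 ha hb hc hd t.coe_nonneg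
  have hL : |meanIntensity μ X t| ≤ M1 := by simpa [meanIntensity] using hM1 t
  have hG : |meanBook μ X t| ≤ M2 := by simpa [meanBook] using hM2 t
  set IL := ∫ s in (0 : ℝ)..t, meanIntensity μ X s
  set IG := ∫ s in (0 : ℝ)..t, meanBook μ X s
  set mL := meanIntensity μ X t
  set mG := meanBook μ X t
  have hIL : IL = mG + (c + d) * IG := by linarith
  have hIG : IG = (b * lam0 * t + (lam0 - mL - b * mG)) / D := by
    rw [eq_div_iff hD0.ne', hD]
    rw [hIL] at h1
    linarith
  have hvar : (b * c / D) ^ 2 * IL + J * IG - lam0 * c / (c + d) * (b * (c + d) / D) ^ 3 * t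
      = (b * c / D) ^ 2 * mG + S / D * (lam0 - mL - b * mG) := by
    rw [hIL, hIG, hS, hJ]
    field_simp
    ring
  rw [hvar]
  have h3 : |lam0 - mL - b * mG| ≤ lam0 + M1 + b * M2 := by
    refine (abs_sub _ _).trans (add_le_add ((abs_sub _ _).trans (add_le_add ?_ hL)) ?_)
    · rw [abs_of_pos hlam0]
    · rw [abs_mul, abs_of_pos hb]
      gcongr
  refine (abs_add_le _ _).trans (add_le_add ?_ ?_)
  · rw [abs_mul, abs_of_nonneg (by positivity : 0 ≤ (b * c / D) ^ 2)]
    gcongr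
  · rw [abs_mul, abs_of_nonneg (by positivity : 0 ≤ S / D)]
    gcongr

/-- The variance of the number of executions differs from that of the martingale part by a
covariance and the variance of a linear form with bounded second moment, hence by at most the order
of the standard deviation. -/
lemma IsBufferHawkes.exists_abs_variance_sub_le (hX : IsBufferHawkes lam0 a b c d μ ℱ X)
    (hlam0 : 0 < lam0) (ha : 0 ≤ a) (hb : 0 < b) (hc : 0 < c) (hd : 0 ≤ d)
    (hstab : a * c < b * (c + d)) :
    ∃ C : ℝ, ∀ t : ℝ≥0, 1 ≤ t →
      |Var[fun ω => ((X t ω).2.2 : ℝ); μ]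
        - lam0 * c / (c + d) * (b * (c + d) / (b * (c + d) - a * c)) ^ 3 * t| ≤ C * √(t : ℝ) := by
  have hD0 : 0 < b * (c + d) - a * c := by linarith
  obtain ⟨R, hR0, hR⟩ := hX.exists_abs_variance_linForm_sub_le hlam0 ha hb hc hd hstab rfl
  set D := b * (c + d) - a * c with hD
  obtain ⟨M, hM⟩ := hX.exists_integral_linForm_sq_le hlam0 ha hb hc hd hstab (c / D) (b * c / D)
  set σ2 := lam0 * c / (c + d) * (b * (c + d) / D) ^ 3 with hσ2
  refine ⟨R + M + 2 * √((σ2 + R) * M), fun t ht => ?_⟩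
  have ht' : (1 : ℝ) ≤ t := by exact_mod_cast ht
  have hH := hX.memLp_linForm hlam0.le ha hb.le hc.le hd (c / D) (b * c / D) 1 t
  have hr := hX.memLp_linForm hlam0.le ha hb.le hc.le hd (c / D) (b * c / D) 0 t
  have hN : (fun ω => ((X t ω).2.2 : ℝ)) = fun ω =>
      onState (linForm (c / D) (b * c / D) 1) (X t ω)
        - onState (linForm (c / D) (b * c / D) 0) (X t ω) := by
    ext ω
    simp only [onState, linForm]
    ring
  rw [hN, variance_fun_sub hH hr]
  have hcov := covariance_sq_le hH hr
  have hr1 : Var[fun ω => onState (linForm (c / D) (b * c / D) 0) (X t ω); μ] ≤ M :=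
    (variance_le_expectation_sq hr.aestronglyMeasurable).trans (hM t)
  have hr0 := variance_nonneg (fun ω => onState (linForm (c / D) (b * c / D) 0) (X t ω)) μ
  have hRt := hR t
  set VH := Var[fun ω => onState (linForm (c / D) (b * c / D) 1) (X t ω); μ]
  set Vr := Var[fun ω => onState (linForm (c / D) (b * c / D) 0) (X t ω); μ]
  set cv := cov[fun ω => onState (linForm (c / D) (b * c / D) 1) (X t ω),
    fun ω => onState (linForm (c / D) (b * c / D) 0) (X t ω); μ]
  have hM0 : 0 ≤ M := hr0.trans hr1
  have hVH : VH ≤ (σ2 + R) * t := by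
    have h1 := (abs_le.1 hRt).2
    have h2 : R ≤ R * t := le_mul_of_one_le_right hR0 ht'
    linarith
  have hcv : |cv| ≤ √((σ2 + R) * M) * √(t : ℝ) := by
    have hσ0 : 0 ≤ σ2 + R := by positivity
    rw [← Real.sqrt_mul (by positivity)]
    refine Real.abs_le_sqrt (hcov.trans ?_)
    calc VH * Vr ≤ ((σ2 + R) * t) * M := mul_le_mul hVH hr1 hr0 (by positivity)
      _ = _ := by ring
  have hs : 1 ≤ √(t : ℝ) := Real.one_le_sqrt.2 ht'
  have h1 := abs_le.1 hRt
  have h2 := abs_le.1 hcv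
  have h3 : R + M ≤ (R + M) * √(t : ℝ) := le_mul_of_one_le_right (by positivity) hs
  rw [abs_le]
  constructor <;> linarith

end Asymptotics

lemma isLittleO_sqrt_coe_nnreal :
    (fun t : ℝ≥0 => √(t : ℝ)) =o[atTop] fun t : ℝ≥0 => (t : ℝ) := by
  have h : (fun x : ℝ => √x) =o[atTop] fun x : ℝ => x := by
    refine isLittleO_of_tendsto' ?_ ?_
    · filter_upwards [eventually_gt_atTop 0] with x hx h0
      exact absurd h0 hx.ne'
    · simp_rw [Real.sqrt_div_self]
      exact Real.tendsto_sqrt_atTop.inv_tendsto_atTop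
  exact h.comp_tendsto (NNReal.tendsto_coe_atTop.2 tendsto_id)

end BufferHawkes

end

/-- The asymptotic variance of the number `N t = (X t).2.2` of executed market orders. Its second
moment is finite at every time, so that the variance is a genuine one. -/
theorem proposition2p2 {Ω : Type*} {mΩ : MeasurableSpace Ω} (μ : Measure Ω)
    [IsProbabilityMeasure μ] (ℱ : Filtration ℝ≥0 mΩ)
    (lam0 a b c d : ℝ) (hlam0 : 0 < lam0) (ha : 0 ≤ a) (hb : 0 < b) (hc : 0 < c) (hd : 0 ≤ d)
    (hstab : a * c < b * (c + d))
    (X : ℝ≥0 → Ω → BufferHawkes.State)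
    (hX : BufferHawkes.IsBufferHawkes lam0 a b c d μ ℱ X) :
    (∀ t : ℝ≥0, MemLp (fun ω => ((X t ω).2.2 : ℝ)) 2 μ) ∧
    (fun t : ℝ≥0 => variance (fun ω => ((X t ω).2.2 : ℝ)) μ) ~[atTop]
      (fun t : ℝ≥0 =>
        lam0 * c / (c + d) * (b * (c + d) / (b * (c + d) - a * c)) ^ 3 * (t : ℝ)) := by
  have hN : ∀ t : ℝ≥0, (fun ω => ((X t ω).2.2 : ℝ))
      = fun ω => BufferHawkes.onState (BufferHawkes.linForm 0 0 1) (X t ω) := fun t => by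
    ext ω
    simp [BufferHawkes.onState, BufferHawkes.linForm]
  refine ⟨fun t => ?_, ?_⟩
  · rw [hN]
    exact hX.memLp_linForm hlam0.le ha hb.le hc.le hd 0 0 1 t
  · obtain ⟨C, hC⟩ := hX.exists_abs_variance_sub_le hlam0 ha hb hc hd hstab
    have hcd : 0 < c + d := by positivity
    have hD : 0 < b * (c + d) - a * c := by linarith
    have hσ : lam0 * c / (c + d) * (b * (c + d) / (b * (c + d) - a * c)) ^ 3 ≠ 0 := by positivity
    have hO : (fun t : ℝ≥0 => variance (fun ω => ((X t ω).2.2 : ℝ)) μ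
        - lam0 * c / (c + d) * (b * (c + d) / (b * (c + d) - a * c)) ^ 3 * (t : ℝ))
        =O[atTop] fun t : ℝ≥0 => √(t : ℝ) := by
      refine IsBigO.of_bound C ?_
      filter_upwards [eventually_ge_atTop 1] with t ht
      rw [Real.norm_eq_abs, Real.norm_of_nonneg (Real.sqrt_nonneg _)]
      exact hC t ht
    exact (hO.trans_isLittleO BufferHawkes.isLittleO_sqrt_coe_nnreal).trans_isBigO
      (isBigO_self_const_mul hσ _ _)
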